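/- Let $F$ be a field, $\delta\in F$ and $r\in\mathbb N_0$. A \emph{diagram} is a perfect matching (by edges) of a $2\times r$ array of dots; an edge within the upper row, within the lower row, or between the rows is called an upper horizontal arc, a lower horizontal arc, or a through arc. Let $D$ be the set of diagrams and let $B_r(\delta)$ be the Brauer algebra, with basis $D$ and with $ab=\delta^{\ell}\,(a\circ b)$ for $a,b\in D$, where $a$ is written on top of $b$, the bottom row of $a$ is connected to the top row of $b$, $a\circ b$ is the resulting diagram on the outer two rows and $\ell$ is the number of closed loops removed. Let $H=\{\delta^k d : k\in\mathbb N_0,\ d\in D\}\subseteq B_r(\delta)$, which is closed under multiplication. \emph{Cycle types.} For $d\in D$, connect each dot of the top row with the dot of the bottom row below it. Follow each connected component of the resulting graph as a closed path, alternating between edges of $d$ and the added vertical edges. The \emph{cycle type} of $d$ is the multiset of the numbers $|\#\{\text{edges of } d \text{ traversed upward}\}-\#\{\text{edges of } d \text{ traversed downward}\}|$, one for each component, zeros included. The \emph{generalized cycle type} of $d$ is the multiset of the strings, one for each component, which record in order the edges of $d$ on the path, with letter $U$ for an upper horizontal arc, $L$ for a lower horizontal arc and $T$ for a through arc; strings are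 considered up to cyclic shifts and reversal. If $h=\delta^k d$ with $d\in D$ of cycle type $(\alpha)$, then $(\alpha,0^k)$ is called a cycle type of $h$. (It is determined by $h$ unless $\delta$ is zero or a root of unity.) Two elements of $H$ have the same cycle type if the sets of their cycle types are equal; for two elements of $D$ this means that they have equal cycle types as diagrams. \emph{Relations.} For $h,h'\in H$ write $h\sim_q h'$ if $h$ and $h'$ have the same cycle type and at least one of the following holds: (i) $h=\delta^k d$ and $h'=\delta^k d'$ for some $k\in\mathbb N_0$ and some $d,d'\in D$ with the same generalized cycle type; (ii) there is $q\in H$ with $h=qh$ and $h'=hq$; (iii) there is $q\in H$ with $h'=qh'$ and $h=h'q$. Let $\sim$ be the transitive closure of $\sim_q$. Two elements of $H$ are \emph{$(uv,vu)$-conjugate} if they are related by the transitive closure of the relation "$h=uv$ and $h'=vu$ for some $u,v\in H$" on $H$. \textbf{Theorem.} Let $d_1,d_2\in D$ have the same cycle type. Then $d_1\sim d_2$, and $d_1$ and $d_2$ are $(uv,vu)$-conjugate. -/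

import Mathlib

namespace Brauer

/-- The dots of a `2 × r` array: `Sum.inl i` is the dot of the top row in column `i`, and
`Sum.inr i` is the dot of the bottom row in column `i`. -/
abbrev Dot (r : ℕ) : Type := Fin r ⊕ Fin r

/-- A diagram on `2r` dots: every dot is joined to exactly one other dot, its partner. -/
@[ext]
structure Diagram (r : ℕ) where
  partner : Dot r → Dot r
  partner_partner : ∀ x, partner (partner x) = x
  partner_ne : ∀ x, partner x ≠ x

/-! ### Concatenation of diagrams -/

/-- The dots of two diagrams written on top of each other:
`Sum.inl x` is a dot of the upper diagram and `Sum.inr x` a dot of the lower one. -/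
abbrev StackDot (r : ℕ) : Type := Dot r ⊕ Dot r

/-- The graph obtained by writing `a` on top of `b` and connecting each dot of the bottom row
of `a` with the dot of the top row of `b` below it. -/
def stackGraph {r : ℕ} (a b : Diagram r) : SimpleGraph (StackDot r) :=
  SimpleGraph.fromRel fun x y =>
    y = Sum.map a.partner b.partner x ∨
      ∃ i : Fin r, x = Sum.inl (Sum.inr i) ∧ y = Sum.inr (Sum.inl i)

/-- The dots of the concatenation, as dots of the stack: the top row of the upper
diagram and the bottom row of the lower diagram. -/
def outer {r : ℕ} : Dot r → StackDot r := Sum.map Sum.inl Sum.inr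

/-- Helper: in an orbit of the group generated by two involutions, the first of which has no
fixed point, a fixed point of the second one is accompanied by exactly one other. -/
theorem existsUnique_other_fixed {V : Type*} [Finite V] (α β : Equiv.Perm V)
    (hα : ∀ v, α (α v) = v) (hβ : ∀ v, β (β v) = v) (hne : ∀ v, α v ≠ v)
    (x : V) (hx : β x = x) :
    ∃! y, y ≠ x ∧ β y = y ∧ ∃ k : ℤ, ((β * α) ^ k) x = y := by
  set p := β * α with hp
  have hinv : p⁻¹ = α * β := by
    rw [inv_eq_iff_mul_eq_one]
    ext v
    simp [hp, hα, hβ]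
  have h1 : ∀ k : ℤ, β * p ^ k = p ^ (-k) * β := by
    intro k
    have : SemiconjBy β p p⁻¹ := by
      rw [hinv]
      ext v
      simp [hp, hβ]
    have := this.zpow_right k
    rw [inv_zpow, ← zpow_neg] at this
    exact this
  have hβk : ∀ k : ℤ, β ((p ^ k) x) = (p ^ (-k)) x := by
    intro k
    have := congrArg (fun e : Equiv.Perm V => e x) (h1 k)
    simpa [hx] using this
  have hαk : ∀ k : ℤ, α ((p ^ k) x) = (p ^ (-k - 1)) x := by
    intro k
    have h2 : β (α ((p ^ k) x)) = (p ^ (k + 1)) x := by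
      rw [add_comm, zpow_add]
      simp [hp]
    rw [← hβ (α ((p ^ k) x)), h2, hβk]
    congr 2
    ring
  have hadd : ∀ a b : ℤ, (p ^ (a + b)) x = (p ^ a) ((p ^ b) x) := by
    intro a b
    rw [zpow_add]
    rfl
  have hper : ∀ n : ℤ, (p ^ n) x = x ↔ ((Function.minimalPeriod p x : ℕ) : ℤ) ∣ n := by
    intro n
    have := MulAction.zpow_smul_eq_iff_minimalPeriod_dvd (a := p) (b := x) (n := n)
    exact this
  have hpos : 0 < Function.minimalPeriod p x := by
    apply Function.minimalPeriod_pos_of_mem_periodicPts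
    exact Function.Injective.mem_periodicPts p.injective x
  set N := Function.minimalPeriod p x with hN
  rcases Nat.even_or_odd' N with ⟨m, hm | hm⟩
  · refine ⟨(p ^ (m : ℤ)) x, ⟨?_, ?_, m, rfl⟩, ?_⟩
    · intro h
      rw [hper] at h
      have h3 := Int.natCast_dvd_natCast.1 h
      have h4 := Nat.le_of_dvd (by omega) h3
      omega
    · rw [hβk]
      have h3 : (p ^ ((m : ℤ) + m)) x = x := (hper _).2 ⟨1, by rw [hm]; push_cast; ring⟩
      have h4 : (p ^ (-(m : ℤ))) ((p ^ ((m : ℤ) + m)) x) = (p ^ (m : ℤ)) x := by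
        rw [← hadd]
        congr 2
        ring
      rwa [h3] at h4
    · rintro y ⟨hyx, hy, k, rfl⟩
      have h3 : (p ^ (k + k)) x = x := by
        rw [hadd]
        rw [hβk] at hy
        have h4 := hadd k (-k)
        rw [add_neg_cancel, zpow_zero, hy] at h4
        exact h4.symm
      obtain ⟨j, hj⟩ := (hper _).1 h3
      have hk : k = m * j := by
        rw [hm] at hj
        push_cast at hj
        linarith
      rcases Int.even_or_odd' j with ⟨i, hi | hi⟩
      · exact absurd ((hper k).2 ⟨i, by rw [hk, hi, hm]; push_cast; ring⟩) hyx
      · have h4 : (p ^ (2 * (m : ℤ) * i)) x = x :=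
          (hper _).2 ⟨i, by rw [hm]; push_cast; ring⟩
        have h5 : k = m + 2 * m * i := by rw [hk, hi]; ring
        rw [h5, hadd, h4]
  · exfalso
    apply hne ((p ^ (m : ℤ)) x)
    rw [hαk]
    have h3 : (p ^ ((m : ℤ) + m + 1)) x = x :=
      (hper _).2 ⟨1, by rw [hm]; push_cast; ring⟩
    nth_rewrite 1 [← h3]
    rw [← hadd]
    congr 2
    ring

theorem outer_injective {r : ℕ} : Function.Injective (outer (r := r)) :=
  Function.Injective.sumMap Sum.inl_injective Sum.inr_injective

/-- The exchange of the dots of the two middle rows of a stack. -/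
def middleSwap {r : ℕ} : StackDot r → StackDot r
  | Sum.inl (Sum.inl i) => Sum.inl (Sum.inl i)
  | Sum.inl (Sum.inr i) => Sum.inr (Sum.inl i)
  | Sum.inr (Sum.inl i) => Sum.inl (Sum.inr i)
  | Sum.inr (Sum.inr i) => Sum.inr (Sum.inr i)

theorem reachable_outer {r : ℕ} (a b : Diagram r) (x : Dot r) :
    ∃! y : Dot r, y ≠ x ∧ (stackGraph a b).Reachable (outer x) (outer y) := by
  have hα : Function.Involutive (Sum.map a.partner b.partner) := by
    rintro (v | v)
    · simp [a.partner_partner]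
    · simp [b.partner_partner]
  have hne : ∀ v, Sum.map a.partner b.partner v ≠ v := by
    rintro (v | v)
    · simpa using a.partner_ne v
    · simpa using b.partner_ne v
  have hβ : Function.Involutive (middleSwap (r := r)) := by
    rintro ((i | i) | (i | i)) <;> rfl
  have hfix : ∀ v : StackDot r, middleSwap v = v ↔ ∃ y, outer y = v := by
    rintro ((i | i) | (i | i)) <;> simp [middleSwap, outer]
  set α := hα.toPerm with hαd
  set β := hβ.toPerm with hβd
  have hα' : ∀ v, α v = Sum.map a.partner b.partner v := fun v => rfl
  have hβ' : ∀ v, β v = middleSwap v := fun v => rfl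
  have hadj : ∀ v w, (stackGraph a b).Adj v w → w = α v ∨ w = β v := by
    rintro v w ⟨-, (h | ⟨i, rfl, rfl⟩) | (h | ⟨i, rfl, rfl⟩)⟩
    · exact Or.inl h
    · exact Or.inr rfl
    · left
      rw [h]
      exact (hα w).symm
    · exact Or.inr rfl
  have hrα : ∀ v, (stackGraph a b).Reachable v (α v) := fun v =>
    SimpleGraph.Adj.reachable ⟨(hne v).symm, Or.inl (Or.inl rfl)⟩
  have hrβ : ∀ v, (stackGraph a b).Reachable v (β v) := by
    rintro ((i | i) | (i | i))
    · exact SimpleGraph.Reachable.refl _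
    · exact SimpleGraph.Adj.reachable ⟨by simp [hβ', middleSwap], Or.inl (Or.inr ⟨i, rfl, rfl⟩)⟩
    · exact SimpleGraph.Adj.reachable ⟨by simp [hβ', middleSwap], Or.inr (Or.inr ⟨i, rfl, rfl⟩)⟩
    · exact SimpleGraph.Reachable.refl _
  have hx : β (outer x) = outer x := (hfix _).2 ⟨x, rfl⟩
  have hreach : ∀ v, (stackGraph a b).Reachable (outer x) v ↔
      ∃ k : ℤ, ((β * α) ^ k) (outer x) = v := by
    intro v
    constructor
    · intro h
      obtain ⟨w⟩ := h
      have key : ∀ (u v : StackDot r) (_ : (stackGraph a b).Walk u v),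
          (∃ k : ℤ, ((β * α) ^ k) (outer x) = u) → ∃ k : ℤ, ((β * α) ^ k) (outer x) = v := by
        intro u v w
        induction w with
        | nil => exact id
        | cons h _ ih =>
          rintro ⟨k, rfl⟩
          apply ih
          have hinv : (β * α)⁻¹ = α * β := by
            rw [inv_eq_iff_mul_eq_one]
            ext v
            simp [show ∀ v, β (β v) = v from hβ, show ∀ v, α (α v) = v from hα]
          have hsc : SemiconjBy β (β * α) (β * α)⁻¹ := by
            rw [hinv]
            ext v
            simp [show ∀ v, β (β v) = v from hβ]
          have hβk : β (((β * α) ^ k) (outer x)) = ((β * α) ^ (-k)) (outer x) := by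
            have h2 := hsc.zpow_right k
            rw [inv_zpow, ← zpow_neg] at h2
            have := congrArg (fun e : Equiv.Perm (StackDot r) => e (outer x)) h2
            simpa only [Equiv.Perm.mul_apply, hx] using this
          rcases hadj _ _ h with h | h
          · refine ⟨-(1 + k), ?_⟩
            have h3 : ((β * α) ^ (1 + k)) (outer x) = β (α (((β * α) ^ k) (outer x))) := by
              rw [zpow_add]
              rfl
            have h4 : ((β * α) ^ (-(1 + k))) (outer x) = β (((β * α) ^ (1 + k)) (outer x)) := by
              have h2 := hsc.zpow_right (1 + k)
              rw [inv_zpow, ← zpow_neg] at h2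
              have := congrArg (fun e : Equiv.Perm (StackDot r) => e (outer x)) h2
              simp only [Equiv.Perm.mul_apply, hx] at this
              exact this.symm
            rw [h, h4, h3]
            exact hβ _
          · exact ⟨-k, by rw [h, hβk]⟩
      exact key _ _ w ⟨0, rfl⟩
    · rintro ⟨k, rfl⟩
      have hstep : ∀ u, (stackGraph a b).Reachable u ((β * α) u) := fun u =>
        (hrα u).trans (hrβ _)
      have hnat : ∀ (n : ℕ) (u), (stackGraph a b).Reachable u (((β * α) ^ n) u) := by
        intro n
        induction n with
        | zero => exact fun u => SimpleGraph.Reachable.refl _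
        | succ n ih =>
          intro u
          rw [pow_succ]
          exact (hstep u).trans (ih _)
      obtain ⟨n, rfl | rfl⟩ := k.eq_nat_or_neg
      · rw [zpow_natCast]
        exact hnat n _
      · have := hnat n (((β * α) ^ (-(n : ℤ))) (outer x))
        rw [zpow_neg, zpow_natCast, ← Equiv.Perm.mul_apply, mul_inv_cancel] at this
        rw [zpow_neg, zpow_natCast]
        exact this.symm
  obtain ⟨v, ⟨hvx, hv, hk⟩, huniq⟩ := existsUnique_other_fixed α β hα hβ hne (outer x) hx
  obtain ⟨y, rfl⟩ := (hfix v).1 hv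
  refine ⟨y, ⟨fun h => hvx (by rw [h]), (hreach _).2 hk⟩, ?_⟩
  rintro z ⟨hz, hz'⟩
  exact outer_injective (huniq (outer z)
    ⟨fun h => hz (outer_injective h), (hfix _).2 ⟨z, rfl⟩, (hreach _).1 hz'⟩)

/-- The diagram underlying the concatenation `a ∘ b`: two dots are joined if and only if they
are the two ends of a path in the stack of `a` and `b`. -/
noncomputable def Diagram.comp {r : ℕ} (a b : Diagram r) : Diagram r where
  partner x := (reachable_outer a b x).choose
  partner_partner x := by
    have h := (reachable_outer a b x).choose_spec.1
    exact ((reachable_outer a b _).choose_spec.2 x ⟨h.1.symm, h.2.symm⟩).symm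
  partner_ne x := (reachable_outer a b x).choose_spec.1.1

/-- The number of loops of the stack of `a` and `b`: the connected components without
outer dots. -/
noncomputable def loops {r : ℕ} (a b : Diagram r) : ℕ :=
  Nat.card {c : (stackGraph a b).ConnectedComponent //
    ∀ x : Dot r, (stackGraph a b).connectedComponentMk (outer x) ≠ c}

/-! ### The Brauer algebra and the monoid of multiples of diagrams -/

/-- The underlying vector space of the Brauer algebra `B_r(δ)`, with basis the diagrams. -/
def BrauerAlgebra (F : Type*) [Field F] (_δ : F) (r : ℕ) : Type _ := Diagram r →₀ F

section

variable {F : Type*} [Field F] {δ : F} {r : ℕ}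

noncomputable instance : AddCommGroup (BrauerAlgebra F δ r) :=
  inferInstanceAs (AddCommGroup (Diagram r →₀ F))

noncomputable instance : Module F (BrauerAlgebra F δ r) :=
  inferInstanceAs (Module F (Diagram r →₀ F))

/-- The multiple `c • d` of a diagram. -/
noncomputable def BrauerAlgebra.single (d : Diagram r) (c : F) : BrauerAlgebra F δ r :=
  Finsupp.single d c

/-- The bilinear extension of `a * b = δ ^ (number of loops) • (a ∘ b)`. -/
noncomputable instance : Mul (BrauerAlgebra F δ r) where
  mul f g := Finsupp.sum f fun a x => Finsupp.sum g fun b y =>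
    BrauerAlgebra.single (a.comp b) (x * y * δ ^ loops a b)

theorem BrauerAlgebra.single_mul_single (a b : Diagram r) (x y : F) :
    (single a x * single b y : BrauerAlgebra F δ r) =
      single (a.comp b) (x * y * δ ^ loops a b) := by
  refine (Finsupp.sum_single_index ?_).trans (Finsupp.sum_single_index ?_)
  · simp [single, Finsupp.sum]
    exact Finset.sum_const_zero
  · simp [single]
    rfl

end

/-- The monoid `H = {δ ^ k d}` of multiples of diagrams, inside the Brauer algebra. -/
def H (F : Type*) [Field F] (δ : F) (r : ℕ) : Set (BrauerAlgebra F δ r) :=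
  {h | ∃ (k : ℕ) (d : Diagram r), h = BrauerAlgebra.single d (δ ^ k)}

section

variable {F : Type*} [Field F] {δ : F} {r : ℕ}

noncomputable instance : Mul (H F δ r) where
  mul u v := ⟨u.1 * v.1, by
    obtain ⟨_, k, a, rfl⟩ := u
    obtain ⟨_, l, b, rfl⟩ := v
    exact ⟨k + l + loops a b, a.comp b, by
      rw [BrauerAlgebra.single_mul_single, pow_add, pow_add]⟩⟩

end

/-- The element `δ ^ k d` of `H`. -/
noncomputable def H.mk {F : Type*} [Field F] (δ : F) {r : ℕ} (k : ℕ) (d : Diagram r) :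
    H F δ r :=
  ⟨BrauerAlgebra.single d (δ ^ k), k, d, rfl⟩

/-! ### Cycle types and generalized cycle types -/

/-- The graph obtained from a diagram by connecting each dot of the top row with the dot of the
bottom row below it. -/
def closureGraph {r : ℕ} (d : Diagram r) : SimpleGraph (Dot r) :=
  SimpleGraph.fromRel fun x y => y = d.partner x ∨ y = x.swap

/-- The columns of the top left dots of the connected components of `closureGraph d`; there is
one such column for each component. -/
noncomputable def leaders {r : ℕ} (d : Diagram r) : Finset (Fin r) :=
  open Classical in
  {i | ∀ j, (closureGraph d).Reachable (Sum.inl i) (Sum.inl j) → i ≤ j}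

/-- One step along a connected component: from a dot traverse the edge of the diagram, then
change the row within the column. -/
def step {r : ℕ} (d : Diagram r) (x : Dot r) : Dot r := (d.partner x).swap

/-- The number of edges of the diagram traversed when following the closed path from the dot
`x` until it returns to `x`. -/
noncomputable def pathLength {r : ℕ} (d : Diagram r) (x : Dot r) : ℕ :=
  Function.minimalPeriod (step d) x

/-- The direction in which the edge from `x` to `y` is traversed: `1` if upward, `-1` if
downward and `0` if the edge is a horizontal arc. -/
def direction {r : ℕ} : Dot r → Dot r → ℤ
  | Sum.inr _, Sum.inl _ => 1
  | Sum.inl _, Sum.inr _ => -1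
  | Sum.inl _, Sum.inl _ => 0
  | Sum.inr _, Sum.inr _ => 0

/-- The absolute value of the difference of the numbers of upward and of downward pointing arcs
on the closed path starting at the dot `x`. -/
noncomputable def windingNumber {r : ℕ} (d : Diagram r) (x : Dot r) : ℕ :=
  (∑ k ∈ Finset.range (pathLength d x),
    direction ((step d)^[k] x) (d.partner ((step d)^[k] x))).natAbs

/-- The cycle type of a diagram: the parts, zeros included, of a partition. -/
noncomputable def cycleType {r : ℕ} (d : Diagram r) : Multiset ℕ :=
  (leaders d).val.map fun i => windingNumber d (Sum.inl i)

/-- Upper horizontal arcs, lower horizontal arcs and through arcs. -/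
inductive Letter : Type
  | U
  | L
  | T

/-- The type of an edge from `x` to `y`. -/
def letter {r : ℕ} : Dot r → Dot r → Letter
  | Sum.inl _, Sum.inl _ => Letter.U
  | Sum.inr _, Sum.inr _ => Letter.L
  | Sum.inl _, Sum.inr _ => Letter.T
  | Sum.inr _, Sum.inl _ => Letter.T

/-- The string of letters read along the closed path starting at the dot `x`. -/
noncomputable def pathString {r : ℕ} (d : Diagram r) (x : Dot r) : List Letter :=
  (List.range (pathLength d x)).map fun k =>
    letter ((step d)^[k] x) (d.partner ((step d)^[k] x))

/-- The generalized cycle type of a diagram. -/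
noncomputable def generalizedCycleType {r : ℕ} (d : Diagram r) : Multiset (List Letter) :=
  (leaders d).val.map fun i => pathString d (Sum.inl i)

/-- Two strings are equivalent if one is obtained from the other by shifting and reversing. -/
def StringEquiv (s t : List Letter) : Prop :=
  ∃ n : ℕ, t = s.rotate n ∨ t = s.reverse.rotate n

/-- Two diagrams have the same generalized cycle type: the strings, with multiplicities, are
the same up to shifting and reversing. -/
def SameGCT {r : ℕ} (d d' : Diagram r) : Prop :=
  Multiset.Rel StringEquiv (generalizedCycleType d) (generalizedCycleType d')

/-! ### The equivalence relations on `H` -/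

section

variable {F : Type*} [Field F] {δ : F} {r : ℕ}

/-- The cycle types of an element of `H`: if `h = δ ^ k d` and `d` has cycle type `α`, then
`(α, 0 ^ k)` is a cycle type of `h`. There is only one, unless `δ` is zero or a root of unity. -/
def cycleTypes (h : H F δ r) : Set (Multiset ℕ) :=
  {μ | ∃ (k : ℕ) (d : Diagram r),
    h = H.mk δ k d ∧ μ = cycleType d + Multiset.replicate k 0}

/-- Helper fact, for diagrams the two notions of having the same cycle type agree. -/
theorem cycleTypes_mk_zero_eq_iff (d d' : Diagram r) :
    cycleTypes (H.mk δ 0 d) = cycleTypes (H.mk δ 0 d') ↔ cycleType d = cycleType d' := by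
  have hmem : ∀ (d : Diagram r) (μ : Multiset ℕ), μ ∈ cycleTypes (H.mk δ 0 d) ↔
      ∃ k : ℕ, δ ^ k = 1 ∧ μ = cycleType d + Multiset.replicate k 0 := by
    intro d μ
    constructor
    · rintro ⟨k, e, h, rfl⟩
      have h2 : Finsupp.single d (δ ^ 0) = Finsupp.single e (δ ^ k) := congrArg Subtype.val h
      rw [pow_zero] at h2
      obtain ⟨rfl, h3⟩ | ⟨h3, -⟩ := Finsupp.single_eq_single_iff _ _ _ _ |>.1 h2
      · exact ⟨k, h3.symm, rfl⟩
      · exact absurd h3 one_ne_zero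
    · rintro ⟨k, hk, rfl⟩
      exact ⟨k, d, Subtype.ext (by simp [H.mk, hk]), rfl⟩
  constructor
  · intro h
    obtain ⟨k, -, hk⟩ := (hmem d' (cycleType d)).1 (h ▸ (hmem d _).2 ⟨0, by simp, by simp⟩)
    obtain ⟨l, -, hl⟩ := (hmem d (cycleType d')).1 (h ▸ (hmem d' _).2 ⟨0, by simp, by simp⟩)
    have h1 := congrArg Multiset.card hk
    have h2 := congrArg Multiset.card hl
    simp only [Multiset.card_add, Multiset.card_replicate] at h1 h2
    obtain rfl : k = 0 := by omega
    simpa using hk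
  · intro h
    ext μ
    rw [hmem, hmem, h]

/-- The relation `∼_q`, whose transitive closure is `∼`. -/
def SimQ (h h' : H F δ r) : Prop :=
  cycleTypes h = cycleTypes h' ∧
    ((∃ (k : ℕ) (d d' : Diagram r), h = H.mk δ k d ∧ h' = H.mk δ k d' ∧ SameGCT d d') ∨
      (∃ q : H F δ r, h = q * h ∧ h' = h * q) ∨
      (∃ q : H F δ r, h' = q * h' ∧ h = h' * q))

/-- The relation `∼`. -/
def Sim : H F δ r → H F δ r → Prop := Relation.TransGen SimQ

/-- The relation `∼'`: `h = uv` and `h' = vu` for some `u, v ∈ H`. -/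
def UVRel (h h' : H F δ r) : Prop := ∃ u v : H F δ r, h = u * v ∧ h' = v * u

/-- `(uv,vu)`-conjugacy. -/
def UVConj : H F δ r → H F δ r → Prop := Relation.TransGen UVRel

end

end Brauer

namespace Brauer

/-! Suppose that an upper arc joins columns i and j, while the lower dots of these columns are not
joined to each other. Then both columns can be deleted: the two edges ending at their lower dots
merge into one edge. In either direction, the deleted stretch of the path passes one upper and one
lower dot, so the winding number is unchanged. Conversely, the larger diagram arises by inserting a
pair of columns into an edge of the smaller one (`insert`, `exists_insert`, `sameCT_insert`). If no
deletion is possible (`Reduced`), each component is either a pair of columns with an upper and a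
lower arc, of winding number 0, or a cycle of through arcs traversed in one direction, as many as
its winding number. Hence a reduced diagram is determined by its cycle type up to a renaming of the
columns (`Reduced.exists_relabel`).

Induction on the number of columns (`conv_of_sameCT`) then connects any two diagrams of the same
cycle type by two moves: renaming columns, and shifting an inserted pair from one edge to another.
The induction step needs that a chain of moves survives a further insertion (`Conv.lift`), which
holds because insertions commute up to renaming (`insert_insert`).

Both moves are realized in H. A renaming preserves the generalized cycle type and is conjugation by
a permutation diagram. For the shift, let q be the identity diagram with a pair inserted at the
lower dot of column k. Multiplying `m.insert u` by q on the left changes nothing, and on the right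
it moves the pair to that lower dot, whatever u was (`insert_composes`, `composes_insert`). So two
positions of the pair are linked through a third one, by condition (ii) and its mirror (iii), and
also by exchanging the factors `m.insert u` and q. No product involved has a loop, so δ plays no
role. -/

/-- A perfect matching of the points of a type, as a fixed point free involution. -/
@[ext]
structure Matching (X : Type*) where
  partner : X → X
  partner_partner : ∀ x, partner (partner x) = x
  partner_ne : ∀ x, partner x ≠ x

namespace Matching

/-- The image of a matching under a bijection. -/
def conj {X Y : Type*} (m : Matching X) (φ : X ≃ Y) : Matching Y where
  partner y := φ (m.partner (φ.symm y))
  partner_partner y := by simp [m.partner_partner]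
  partner_ne y h := m.partner_ne (φ.symm y) (φ.injective (by simpa using h))

@[simp]
theorem conj_partner {X Y : Type*} (m : Matching X) (φ : X ≃ Y) (y : Y) :
    (m.conj φ).partner y = φ (m.partner (φ.symm y)) := rfl

theorem conj_conj {X Y Z : Type*} (m : Matching X) (φ : X ≃ Y) (ψ : Y ≃ Z) :
    (m.conj φ).conj ψ = m.conj (φ.trans ψ) := rfl

@[simp]
theorem conj_refl {X : Type*} (m : Matching X) : m.conj (Equiv.refl X) = m := rfl

/-! ### Closed paths as orbits of a permutation -/

variable {V W : Type}

/-- Rename the columns of a diagram. -/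
def relabel (m : Matching (V ⊕ V)) (e : V ≃ W) : Matching (W ⊕ W) :=
  m.conj (e.sumCongr e)

/-- Traverse an edge, then change the row within the column. -/
def turn (m : Matching (V ⊕ V)) : Equiv.Perm (V ⊕ V) where
  toFun x := (m.partner x).swap
  invFun x := m.partner x.swap
  left_inv x := by simp [m.partner_partner]
  right_inv x := by simp [m.partner_partner]

theorem turn_apply (m : Matching (V ⊕ V)) (x : V ⊕ V) : m.turn x = (m.partner x).swap := rfl

theorem turn_symm_apply (m : Matching (V ⊕ V)) (x : V ⊕ V) :
    m.turn.symm x = m.partner x.swap := rfl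

/-- `turn` is the product of the two involutions `partner` and `Sum.swap`, so conjugation by
`Sum.swap` inverts it: changing the row amounts to following the path backwards. -/
theorem turn_zpow_swap (m : Matching (V ⊕ V)) (n : ℤ) (x : V ⊕ V) :
    (m.turn ^ n) x.swap = ((m.turn ^ (-n)) x).swap := by
  have h : SemiconjBy (Equiv.sumComm V V : Equiv.Perm (V ⊕ V)) m.turn m.turn⁻¹ := by
    ext y : 1
    simp [turn_apply, turn_symm_apply, Equiv.Perm.inv_def]
  have h2 := (h.zpow_right (-n))
  rw [inv_zpow, zpow_neg, inv_inv] at h2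
  have := congrArg (fun e : Equiv.Perm (V ⊕ V) => e x) h2
  simp only [Equiv.Perm.mul_apply, Equiv.sumComm_apply] at this
  rw [zpow_neg]
  exact this.symm

theorem sameCycle_swap (m : Matching (V ⊕ V)) {x y : V ⊕ V} :
    m.turn.SameCycle x.swap y.swap ↔ m.turn.SameCycle x y := by
  constructor
  · rintro ⟨n, h⟩
    refine ⟨-n, ?_⟩
    rw [turn_zpow_swap] at h
    exact Sum.swap_rightInverse.injective h
  · rintro ⟨n, h⟩
    exact ⟨-n, by rw [turn_zpow_swap, neg_neg, h]⟩

/-- No orbit of `turn` is mapped to itself by the exchange of rows. -/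
theorem not_sameCycle_swap (m : Matching (V ⊕ V)) (x : V ⊕ V) :
    ¬ m.turn.SameCycle x x.swap := by
  rintro ⟨n, h⟩
  have hadd : ∀ a b : ℤ, (m.turn ^ a) ((m.turn ^ b) x) = (m.turn ^ (a + b)) x := by
    intro a b
    rw [zpow_add]
    rfl
  rcases Int.even_or_odd' n with ⟨k, rfl | rfl⟩
  -- Halfway along a path from `x` to `x.swap` there would be a dot equal to its own swap (even
  -- length) or to its own partner (odd length).
  · have h1 : ((m.turn ^ k) x) = ((m.turn ^ k) x).swap := by
      have := congrArg (m.turn ^ (-k)) h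
      rw [turn_zpow_swap, hadd, neg_neg] at this
      rwa [show -k + 2 * k = k by ring] at this
    rcases h2 : (m.turn ^ k) x with i | i <;> simp [h2] at h1
  · have h1 : m.turn ((m.turn ^ k) x) = ((m.turn ^ k) x).swap := by
      have := congrArg (m.turn ^ (-k)) h
      rw [turn_zpow_swap, hadd, neg_neg] at this
      rw [← this]
      have h3 := hadd 1 k
      rw [zpow_one] at h3
      rw [h3]
      congr 2
      ring
    rw [turn_apply] at h1
    exact m.partner_ne _ (Sum.swap_rightInverse.injective h1)

/-- Two dots are equivalent if they lie on the same closed path. -/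
def conn (m : Matching (V ⊕ V)) : Setoid (V ⊕ V) where
  r x y := m.turn.SameCycle x y ∨ m.turn.SameCycle x y.swap
  iseqv :=
    { refl := fun x => Or.inl (Equiv.Perm.SameCycle.refl _ _)
      symm := by
        rintro x y (h | h)
        · exact Or.inl h.symm
        · right
          rw [← sameCycle_swap] at h
          simpa using h.symm
      trans := by
        have hs : ∀ {x y : V ⊕ V}, m.turn.SameCycle x y.swap → m.turn.SameCycle x.swap y := by
          intro x y h
          rw [← sameCycle_swap] at h
          simpa using h
        rintro x y z (h | h) (h' | h')
        · exact Or.inl (h.trans h')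
        · exact Or.inr (h.trans h')
        · exact Or.inr (h.trans (m.sameCycle_swap.2 h'))
        · exact Or.inl (h.trans (hs h')) }

theorem conn_def (m : Matching (V ⊕ V)) (x y : V ⊕ V) :
    m.conn x y ↔ m.turn.SameCycle x y ∨ m.turn.SameCycle x y.swap := Iff.rfl

theorem conn_swap (m : Matching (V ⊕ V)) (x : V ⊕ V) : m.conn x x.swap :=
  Or.inr (by rw [Sum.swap_swap])

theorem conn_partner (m : Matching (V ⊕ V)) (x : V ⊕ V) : m.conn x (m.partner x) :=
  Or.inr ⟨1, by simp [turn_apply]⟩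

/-- The sign of a dot. -/
def sign : V ⊕ V → ℤ := Sum.elim (fun _ => -1) (fun _ => 1)

@[simp] theorem sign_inl (v : V) : sign (Sum.inl v : V ⊕ V) = -1 := rfl

@[simp] theorem sign_inr (v : V) : sign (Sum.inr v : V ⊕ V) = 1 := rfl

theorem sign_swap (x : V ⊕ V) : sign x.swap = - sign x := by
  rcases x with x | x <;> rfl

/-! ### Winding numbers and cycle types -/

section winding

variable [Fintype V] [Fintype W]

/-- The sum of the signs on an orbit of `turn`. -/
noncomputable def orbitSum (m : Matching (V ⊕ V)) (x : V ⊕ V) : ℤ :=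
  ∑ y, {y | m.turn.SameCycle x y}.indicator sign y

theorem orbitSum_congr (m : Matching (V ⊕ V)) {x y : V ⊕ V} (h : m.turn.SameCycle x y) :
    m.orbitSum x = m.orbitSum y := by
  unfold orbitSum
  have : ∀ z, m.turn.SameCycle x z ↔ m.turn.SameCycle y z := fun z =>
    ⟨fun h' => h.symm.trans h', fun h' => h.trans h'⟩
  simp only [this]

/-- The opposite direction visits the other dot of each column. Hence only the absolute value of the
sum belongs to the component. -/
theorem orbitSum_swap (m : Matching (V ⊕ V)) (x : V ⊕ V) :
    m.orbitSum x.swap = - m.orbitSum x := by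
  unfold orbitSum
  rw [← Equiv.sum_comp (Equiv.sumComm V V), ← Finset.sum_neg_distrib]
  refine Finset.sum_congr rfl fun z _ => ?_
  by_cases h : m.turn.SameCycle x z
  · simp [Set.indicator, h, sameCycle_swap, sign_swap]
  · simp [Set.indicator, h, sameCycle_swap]

/-- The winding number of the closed path through a dot. -/
noncomputable def winding (m : Matching (V ⊕ V)) (x : V ⊕ V) : ℕ := (m.orbitSum x).natAbs

theorem winding_congr (m : Matching (V ⊕ V)) {x y : V ⊕ V} (h : m.conn x y) :
    m.winding x = m.winding y := by
  unfold winding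
  rcases h with h | h
  · rw [m.orbitSum_congr h]
  · rw [m.orbitSum_congr h, orbitSum_swap, Int.natAbs_neg]

/-- The winding number of a component. -/
noncomputable def windingOf (m : Matching (V ⊕ V)) : Quotient m.conn → ℕ :=
  Quotient.lift m.winding fun _ _ h => m.winding_congr h

/-- The components of two diagrams correspond, with equal winding numbers. -/
def SameCT (m : Matching (V ⊕ V)) (m' : Matching (W ⊕ W)) : Prop :=
  ∃ e : Quotient m.conn ≃ Quotient m'.conn, ∀ c, m'.windingOf (e c) = m.windingOf c

theorem SameCT.symm {m : Matching (V ⊕ V)} {m' : Matching (W ⊕ W)} :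
    SameCT m m' → SameCT m' m := by
  rintro ⟨e, h⟩
  exact ⟨e.symm, fun c => by rw [← h, e.apply_symm_apply]⟩

theorem SameCT.trans {X : Type} [Fintype X] {m : Matching (V ⊕ V)} {m' : Matching (W ⊕ W)}
    {m'' : Matching (X ⊕ X)} : SameCT m m' → SameCT m' m'' → SameCT m m'' := by
  rintro ⟨e, h⟩ ⟨e', h'⟩
  exact ⟨e.trans e', fun c => by rw [Equiv.trans_apply, h', h]⟩

theorem sameCT_of_map {m : Matching (V ⊕ V)} {m' : Matching (W ⊕ W)} (f : V ⊕ V → W ⊕ W)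
    (hf : ∀ x y, m.conn x y ↔ m'.conn (f x) (f y)) (hs : ∀ y, ∃ x, m'.conn (f x) y)
    (hw : ∀ x, m'.winding (f x) = m.winding x) : SameCT m m' := by
  refine ⟨Equiv.ofBijective (Quotient.map f fun x y h => (hf x y).1 h) ⟨?_, ?_⟩, ?_⟩
  · rintro ⟨x⟩ ⟨y⟩ h
    exact Quotient.sound ((hf x y).2 (Quotient.exact h))
  · rintro ⟨y⟩
    obtain ⟨x, hx⟩ := hs y
    exact ⟨Quotient.mk _ x, Quotient.sound hx⟩
  · rintro ⟨x⟩
    exact hw x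

end winding

/-! ### Invariance under renaming of the columns -/

theorem turn_relabel (m : Matching (V ⊕ V)) (e : V ≃ W) (x : V ⊕ V) :
    (m.relabel e).turn (Sum.map e e x) = Sum.map e e (m.turn x) := by
  rw [turn_apply, turn_apply, relabel, conj_partner]
  rcases x with x | x <;> simp <;> rcases m.partner _ with y | y <;> rfl

theorem turn_zpow_relabel (m : Matching (V ⊕ V)) (e : V ≃ W) (n : ℤ) (x : V ⊕ V) :
    ((m.relabel e).turn ^ n) (Sum.map e e x) = Sum.map e e ((m.turn ^ n) x) := by
  have h : (m.relabel e).turn = (e.sumCongr e).permCongr m.turn := by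
    ext y : 1
    obtain ⟨x, rfl⟩ := (e.sumCongr e).surjective y
    simpa using m.turn_relabel e x
  have h2 : ∀ n : ℤ, ((e.sumCongr e).permCongr m.turn) ^ n =
      (e.sumCongr e).permCongr (m.turn ^ n) := by
    intro n
    exact (map_zpow (e.sumCongr e).permCongrHom m.turn n).symm
  rw [h, h2]
  simp [Equiv.permCongr_apply]

theorem sameCycle_relabel (m : Matching (V ⊕ V)) (e : V ≃ W) {x y : V ⊕ V} :
    (m.relabel e).turn.SameCycle (Sum.map e e x) (Sum.map e e y) ↔ m.turn.SameCycle x y := by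
  refine exists_congr fun n => ?_
  rw [turn_zpow_relabel]
  exact (Function.Injective.sumMap e.injective e.injective).eq_iff

theorem conn_relabel (m : Matching (V ⊕ V)) (e : V ≃ W) (x y : V ⊕ V) :
    m.conn x y ↔ (m.relabel e).conn (Sum.map e e x) (Sum.map e e y) := by
  have hswap : (Sum.map e e y).swap = Sum.map e e y.swap := by
    rcases y with y | y <;> rfl
  rw [conn_def, conn_def, hswap, sameCycle_relabel, sameCycle_relabel]

theorem sameCT_relabel [Fintype V] [Fintype W] (m : Matching (V ⊕ V)) (e : V ≃ W) :
    SameCT m (m.relabel e) := by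
  refine sameCT_of_map (Sum.map e e) (m.conn_relabel e) ?_ ?_
  · intro y
    exact ⟨Sum.map e.symm e.symm y, by simp⟩
  · intro x
    unfold winding orbitSum
    rw [← Equiv.sum_comp (e.sumCongr e)]
    congr 1
    refine Finset.sum_congr rfl fun y _ => ?_
    have hs : sign (Sum.map e e y) = sign y := by
      rcases y with y | y <;> rfl
    by_cases h : m.turn.SameCycle x y
    · simp [Set.indicator, h, sameCycle_relabel, hs]
    · simp [Set.indicator, h, sameCycle_relabel]

/-! ### Insertion of a pair of columns -/

/-- Add two columns whose upper dots and whose lower dots are joined. -/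
def addPair (m : Matching (W ⊕ W)) : Matching ((W ⊕ Bool) ⊕ (W ⊕ Bool)) where
  partner
    | Sum.inl (Sum.inl w) => Sum.map Sum.inl Sum.inl (m.partner (Sum.inl w))
    | Sum.inr (Sum.inl w) => Sum.map Sum.inl Sum.inl (m.partner (Sum.inr w))
    | Sum.inl (Sum.inr b) => Sum.inl (Sum.inr !b)
    | Sum.inr (Sum.inr b) => Sum.inr (Sum.inr !b)
  partner_partner := by
    rintro ((w | b) | (w | b))
    · have h := m.partner_partner (Sum.inl w)
      rcases h' : m.partner (Sum.inl w) with y | y <;> rw [h'] at h <;> simp [h, h']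
    · simp
    · have h := m.partner_partner (Sum.inr w)
      rcases h' : m.partner (Sum.inr w) with y | y <;> rw [h'] at h <;> simp [h, h']
    · simp
  partner_ne := by
    rintro ((w | b) | (w | b))
    · have h := m.partner_ne (Sum.inl w)
      rcases h' : m.partner (Sum.inl w) with y | y <;> rw [h'] at h <;> simp_all
    · simp
    · have h := m.partner_ne (Sum.inr w)
      rcases h' : m.partner (Sum.inr w) with y | y <;> rw [h'] at h <;> simp_all
    · simp

/-- The inclusion of the dots of the old columns. -/
abbrev old (x : W ⊕ W) : (W ⊕ Bool) ⊕ (W ⊕ Bool) := Sum.map Sum.inl Sum.inl x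

theorem old_injective : Function.Injective (old (W := W)) :=
  Function.Injective.sumMap Sum.inl_injective Sum.inl_injective

@[simp]
theorem addPair_old (m : Matching (W ⊕ W)) (x : W ⊕ W) :
    m.addPair.partner (old x) = old (m.partner x) := by
  rcases x with x | x <;> rfl

@[simp]
theorem addPair_inl (m : Matching (W ⊕ W)) (b : Bool) :
    m.addPair.partner (Sum.inl (Sum.inr b)) = Sum.inl (Sum.inr !b) := rfl

@[simp]
theorem addPair_inr (m : Matching (W ⊕ W)) (b : Bool) :
    m.addPair.partner (Sum.inr (Sum.inr b)) = Sum.inr (Sum.inr !b) := rfl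

open Classical in
/-- The exchange of an old dot with a new lower dot. -/
noncomputable def exch (u : W ⊕ W) : Equiv.Perm ((W ⊕ Bool) ⊕ (W ⊕ Bool)) :=
  Equiv.swap (old u) (Sum.inr (Sum.inr false))

/-- Insert two new columns, with upper dots joined, next to the dot `u`. -/
noncomputable def insert (m : Matching (W ⊕ W)) (u : W ⊕ W) :
    Matching ((W ⊕ Bool) ⊕ (W ⊕ Bool)) :=
  m.addPair.conj (exch u)

theorem old_ne_inl (x : W ⊕ W) (b : Bool) : old x ≠ Sum.inl (Sum.inr b) := by
  rcases x with x | x <;> simp [old]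

theorem old_ne_inr (x : W ⊕ W) (b : Bool) : old x ≠ Sum.inr (Sum.inr b) := by
  rcases x with x | x <;> simp [old]

theorem exch_symm (u : W ⊕ W) : (exch u).symm = exch u := by
  classical exact Equiv.symm_swap _ _

theorem exch_old_self (u : W ⊕ W) : exch u (old u) = Sum.inr (Sum.inr false) := by
  classical exact Equiv.swap_apply_left _ _

theorem exch_false (u : W ⊕ W) : exch u (Sum.inr (Sum.inr false)) = old u := by
  classical exact Equiv.swap_apply_right _ _

theorem exch_old_of_ne {u x : W ⊕ W} (h : x ≠ u) : exch u (old x) = old x := by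
  classical exact Equiv.swap_apply_of_ne_of_ne (old_injective.ne h) (old_ne_inr _ _)

@[simp]
theorem exch_inl (u : W ⊕ W) (b : Bool) :
    exch u (Sum.inl (Sum.inr b)) = Sum.inl (Sum.inr b) := by
  classical exact Equiv.swap_apply_of_ne_of_ne (old_ne_inl _ _).symm (by simp)

@[simp]
theorem exch_true (u : W ⊕ W) :
    exch u (Sum.inr (Sum.inr true)) = Sum.inr (Sum.inr true) := by
  classical exact Equiv.swap_apply_of_ne_of_ne (old_ne_inr _ _).symm (by simp)

@[simp]
theorem insert_inl (m : Matching (W ⊕ W)) (u : W ⊕ W) (b : Bool) :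
    (m.insert u).partner (Sum.inl (Sum.inr b)) = Sum.inl (Sum.inr !b) := by
  simp [insert, exch_symm]

theorem insert_true (m : Matching (W ⊕ W)) (u : W ⊕ W) :
    (m.insert u).partner (Sum.inr (Sum.inr true)) = old u := by
  simp [insert, exch_symm, exch_false]

theorem insert_false (m : Matching (W ⊕ W)) (u : W ⊕ W) :
    (m.insert u).partner (Sum.inr (Sum.inr false)) = old (m.partner u) := by
  rw [insert, conj_partner, exch_symm, exch_false, addPair_old, exch_old_of_ne (m.partner_ne u)]

theorem insert_old_self (m : Matching (W ⊕ W)) (u : W ⊕ W) :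
    (m.insert u).partner (old u) = Sum.inr (Sum.inr true) := by
  rw [← insert_true, partner_partner]

theorem insert_old_partner (m : Matching (W ⊕ W)) (u : W ⊕ W) :
    (m.insert u).partner (old (m.partner u)) = Sum.inr (Sum.inr false) := by
  rw [← insert_false, partner_partner]

theorem insert_old_of_ne (m : Matching (W ⊕ W)) {u x : W ⊕ W} (h : x ≠ u)
    (h' : x ≠ m.partner u) : (m.insert u).partner (old x) = old (m.partner x) := by
  rw [insert, conj_partner, exch_symm, exch_old_of_ne h, addPair_old, exch_old_of_ne]
  rintro rfl
  exact h' (m.partner_partner x).symm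

theorem swap_old (x : W ⊕ W) : (old x).swap = old x.swap := by
  rcases x with x | x <;> rfl

/-- The new orbits are the old ones, except that crossing the edge between `u` and its partner, in
either direction, takes a detour through one upper and one lower new dot. -/
theorem turn_insert_old (m : Matching (W ⊕ W)) (u x : W ⊕ W) :
    (m.insert u).turn (old x) = old (m.turn x) ∨
      ∃ b, (m.insert u).turn (old x) = Sum.inl (Sum.inr b) ∧
        (m.insert u).turn (Sum.inl (Sum.inr b)) = Sum.inr (Sum.inr !b) ∧
        (m.insert u).turn (Sum.inr (Sum.inr !b)) = old (m.turn x) := by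
  by_cases h : x = u
  · subst h
    right
    refine ⟨true, ?_, ?_, ?_⟩
    · rw [turn_apply, insert_old_self]
      rfl
    · rw [turn_apply, insert_inl]
      rfl
    · rw [turn_apply, Bool.not_true, insert_false, swap_old, turn_apply]
  · by_cases h' : x = m.partner u
    · subst h'
      right
      refine ⟨false, ?_, ?_, ?_⟩
      · rw [turn_apply, insert_old_partner]
        rfl
      · rw [turn_apply, insert_inl]
        rfl
      · rw [turn_apply, Bool.not_false, insert_true, swap_old, turn_apply, partner_partner]
    · left
      rw [turn_apply, insert_old_of_ne _ h h', swap_old, turn_apply]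

theorem sameCycle_insert [Finite W] (m : Matching (W ⊕ W)) (u : W ⊕ W) {x y : W ⊕ W} :
    (m.insert u).turn.SameCycle (old x) (old y) ↔ m.turn.SameCycle x y := by
  constructor
  · intro h
    obtain ⟨n, -, h⟩ := h.exists_pow_eq'
    -- Strong induction, since one step in `m` may cost three steps here; the path cannot stop
    -- inside a detour because `old y` is not a new dot.
    have key : ∀ (n : ℕ) (x : W ⊕ W), ((m.insert u).turn ^ n) (old x) = old y →
        m.turn.SameCycle x y := by
      intro n
      induction n using Nat.strong_induction_on with
      | _ n ih =>
        intro x h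
        match n, ih, h with
        | 0, _, h => exact (old_injective h) ▸ Equiv.Perm.SameCycle.refl _ _
        | n + 1, ih, h =>
          rw [pow_succ, Equiv.Perm.mul_apply] at h
          rcases turn_insert_old m u x with h1 | ⟨b, h1, h2, h3⟩
          · rw [h1] at h
            exact Equiv.Perm.sameCycle_apply_left.1 (ih n (by omega) _ h)
          · rw [h1] at h
            match n, ih, h with
            | 0, _, h => exact absurd h.symm (old_ne_inl _ _)
            | n + 1, ih, h =>
              rw [pow_succ, Equiv.Perm.mul_apply, h2] at h
              match n, ih, h with
              | 0, _, h => exact absurd h.symm (old_ne_inr _ _)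
              | n + 1, ih, h =>
                rw [pow_succ, Equiv.Perm.mul_apply, h3] at h
                exact Equiv.Perm.sameCycle_apply_left.1 (ih n (by omega) _ h)
    exact key n x h
  · intro h
    obtain ⟨n, -, rfl⟩ := h.exists_pow_eq'
    clear h
    induction n with
    | zero => exact Equiv.Perm.SameCycle.refl _ _
    | succ n ih =>
      refine ih.trans ?_
      rw [pow_succ', Equiv.Perm.mul_apply]
      rcases turn_insert_old m u ((m.turn ^ n) x) with h1 | ⟨b, h1, h2, h3⟩
      · exact ⟨1, by rw [zpow_one, h1]⟩
      · refine ⟨(3 : ℕ), ?_⟩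
        rw [zpow_natCast, pow_succ, pow_succ, pow_one, Equiv.Perm.mul_apply,
          Equiv.Perm.mul_apply, h1, h2, h3]

theorem sameCT_insert [Fintype W] (m : Matching (W ⊕ W)) (u : W ⊕ W) :
    SameCT m (m.insert u) := by
  refine sameCT_of_map old ?_ ?_ ?_
  · intro x y
    rw [conn_def, conn_def, swap_old, sameCycle_insert, sameCycle_insert]
  · have h : ∀ b, ∃ x, (m.insert u).conn (old x) (Sum.inr (Sum.inr b)) := by
      rintro (_ | _)
      · refine ⟨m.partner u, ?_⟩
        rw [← insert_old_partner]
        exact conn_partner _ _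
      · refine ⟨u, ?_⟩
        rw [← insert_old_self]
        exact conn_partner _ _
    rintro ((w | b) | (w | b))
    · exact ⟨Sum.inl w, (m.insert u).conn.refl _⟩
    · obtain ⟨x, hx⟩ := h b
      exact ⟨x, (m.insert u).conn.trans hx (conn_swap _ _)⟩
    · exact ⟨Sum.inr w, (m.insert u).conn.refl _⟩
    · exact h b
  · intro x
    unfold winding orbitSum
    congr 1
    have h : ∀ b, (m.insert u).turn.SameCycle (old x) (Sum.inl (Sum.inr b)) ↔
        (m.insert u).turn.SameCycle (old x) (Sum.inr (Sum.inr !b)) := by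
      intro b
      have h : (m.insert u).turn (Sum.inl (Sum.inr b)) = Sum.inr (Sum.inr !b) := by
        rw [turn_apply, insert_inl]
        rfl
      rw [← h, Equiv.Perm.sameCycle_apply_right]
    -- The two new dots of a detour lie on the same orbit and have opposite signs, so they cancel.
    have hnew : ∀ b, {y | (m.insert u).turn.SameCycle (old x) y}.indicator sign
        (Sum.inl (Sum.inr b)) = - {y | (m.insert u).turn.SameCycle (old x) y}.indicator sign
        (Sum.inr (Sum.inr !b)) := by
      intro b
      by_cases h' : (m.insert u).turn.SameCycle (old x) (Sum.inr (Sum.inr !b))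
      · simp [Set.indicator, h, h']
      · simp [Set.indicator, h, h']
    have hold : ∀ y, {y | (m.insert u).turn.SameCycle (old x) y}.indicator sign (old y) =
        {y | m.turn.SameCycle x y}.indicator sign y := by
      intro y
      have hs : sign (old y) = sign y := by
        rcases y with y | y <;> rfl
      by_cases h' : m.turn.SameCycle x y
      · rw [Set.indicator_of_mem, Set.indicator_of_mem, hs]
        · exact h'
        · exact (m.sameCycle_insert u).2 h'
      · rw [Set.indicator_of_notMem, Set.indicator_of_notMem]
        · exact h'
        · exact fun h => h' ((m.sameCycle_insert u).1 h)
    have hl := fun w => hold (Sum.inl w)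
    have hr := fun w => hold (Sum.inr w)
    simp only [old, Sum.map_inl, Sum.map_inr] at hl hr
    simp only [Fintype.sum_sum_type, Fintype.sum_bool, hnew, hl, hr, Bool.not_true, Bool.not_false]
    ring

theorem turn_zpow_eq_iff (m : Matching (V ⊕ V)) (x : V ⊕ V) (n : ℤ) :
    (m.turn ^ n) x = x ↔ (Function.minimalPeriod m.turn x : ℤ) ∣ n :=
  MulAction.zpow_smul_eq_iff_minimalPeriod_dvd (a := m.turn) (b := x) (n := n)

theorem orbitSum_eq_sum_range [Fintype V] (m : Matching (V ⊕ V)) (x : V ⊕ V) :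
    m.orbitSum x =
      ∑ k ∈ Finset.range (Function.minimalPeriod m.turn x), sign (m.turn^[k] x) := by
  classical
  have hinj : Set.InjOn (fun k => m.turn^[k] x)
      (Finset.range (Function.minimalPeriod m.turn x)) := by
    rw [Finset.coe_range]
    exact Function.iterate_injOn_Iio_minimalPeriod
  have hpos : 0 < Function.minimalPeriod m.turn x :=
    Function.minimalPeriod_pos_of_mem_periodicPts
      (Function.Injective.mem_periodicPts m.turn.injective x)
  have hmem : ∀ y, y ∈ (Finset.range (Function.minimalPeriod m.turn x)).image
      (fun k => m.turn^[k] x) ↔ m.turn.SameCycle x y := by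
    intro y
    simp only [Finset.mem_image, Finset.mem_range]
    constructor
    · rintro ⟨k, -, rfl⟩
      exact ⟨k, by rw [zpow_natCast, ← Equiv.Perm.iterate_eq_pow]⟩
    · intro h
      obtain ⟨k, -, rfl⟩ := h.exists_pow_eq'
      exact ⟨k % _, Nat.mod_lt _ hpos, by
        rw [Function.iterate_mod_minimalPeriod_eq, Equiv.Perm.iterate_eq_pow]⟩
  rw [← Finset.sum_image (f := sign) hinj, orbitSum]
  symm
  refine (Finset.sum_congr rfl fun y hy => ?_).trans
    (Finset.sum_subset (Finset.subset_univ _) fun y _ hy => ?_)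
  · exact (Set.indicator_of_mem (s := {y | m.turn.SameCycle x y}) ((hmem y).1 hy) _).symm
  · exact Set.indicator_of_notMem (s := {y | m.turn.SameCycle x y}) (fun h => hy ((hmem y).2 h)) _

/-! ### Diagrams with matching closed paths differ by a renaming of the columns -/

/-- The dots on the closed paths through the dots of a family. -/
def param {ι : Type} (m : Matching (V ⊕ V)) (x : ι → V ⊕ V) (a : ι × ℤ × Bool) : V ⊕ V :=
  bif a.2.2 then ((m.turn ^ a.2.1) (x a.1)).swap else (m.turn ^ a.2.1) (x a.1)

theorem param_surjective {ι : Type} (m : Matching (V ⊕ V)) (x : ι → V ⊕ V)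
    (hx : Function.Surjective fun i => (Quotient.mk m.conn (x i))) :
    Function.Surjective (m.param x) := by
  intro y
  obtain ⟨i, hi⟩ := hx (Quotient.mk _ y)
  rcases (Quotient.exact hi : m.conn (x i) y) with ⟨n, h⟩ | ⟨n, h⟩
  · exact ⟨(i, n, false), h⟩
  · exact ⟨(i, n, true), by simp [param, h]⟩

/-- The only coincidences come from the period: different indices give different components, and the
two directions of a path never meet by `not_sameCycle_swap`. -/
theorem param_eq_iff {ι : Type} (m : Matching (V ⊕ V)) (x : ι → V ⊕ V)
    (hx : Function.Injective fun i => (Quotient.mk m.conn (x i))) (a b : ι × ℤ × Bool) :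
    m.param x a = m.param x b ↔
      a.1 = b.1 ∧ a.2.2 = b.2.2 ∧ (m.turn ^ (a.2.1 - b.2.1)) (x a.1) = x a.1 := by
  obtain ⟨i, n, s⟩ := a
  obtain ⟨j, k, t⟩ := b
  have hmk : ∀ (i : ι) (n : ℤ) (s : Bool), Quotient.mk m.conn (m.param x (i, n, s)) =
      Quotient.mk m.conn (x i) := by
    intro i n s
    refine (Quotient.sound ?_).symm
    cases s
    · exact Or.inl ⟨n, rfl⟩
    · exact Or.inr ⟨n, by simp [param]⟩
  have hper : (m.turn ^ n) (x i) = (m.turn ^ k) (x i) ↔ (m.turn ^ (n - k)) (x i) = x i := by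
    rw [sub_eq_neg_add, zpow_add, zpow_neg, Equiv.Perm.mul_apply, Equiv.Perm.inv_eq_iff_eq,
      eq_comm, eq_comm (a := (m.turn ^ k) (x i))]
  have hne : ∀ n k : ℤ, (m.turn ^ n) (x i) ≠ ((m.turn ^ k) (x i)).swap := by
    intro n k h
    apply m.not_sameCycle_swap ((m.turn ^ k) (x i))
    rw [← h]
    exact Equiv.Perm.SameCycle.trans (y := x i) (Equiv.Perm.SameCycle.symm ⟨k, rfl⟩) ⟨n, rfl⟩
  simp only
  constructor
  · intro h
    have hij : i = j := hx (by simpa only [hmk] using congrArg (Quotient.mk m.conn) h)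
    subst hij
    refine ⟨rfl, ?_⟩
    rw [← hper]
    cases s <;> cases t
    · exact ⟨rfl, h⟩
    · exact absurd h (hne _ _)
    · exact absurd h.symm (hne _ _)
    · exact ⟨rfl, Sum.swap_rightInverse.injective h⟩
  · rintro ⟨rfl, rfl, h⟩
    rw [← hper] at h
    cases s
    · exact h
    · exact congrArg Sum.swap h

theorem exists_equiv_of_kernel {I X Y : Type} {f : I → X} {g : I → Y}
    (hf : Function.Surjective f) (hg : Function.Surjective g)
    (h : ∀ a b, f a = f b ↔ g a = g b) : ∃ φ : X ≃ Y, ∀ a, φ (f a) = g a := by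
  have key : ∀ a, g (Function.surjInv hf (f a)) = g a := fun a =>
    (h _ _).1 (Function.surjInv_eq hf (f a))
  refine ⟨Equiv.ofBijective (fun y => g (Function.surjInv hf y)) ⟨?_, ?_⟩, key⟩
  · intro y z hyz
    have := (h _ _).2 hyz
    rwa [Function.surjInv_eq hf, Function.surjInv_eq hf] at this
  · intro y
    obtain ⟨a, rfl⟩ := hg y
    exact ⟨f a, key a⟩

/-- A bijection preserving rows and columns is a renaming of columns. -/
theorem exists_sumCongr (φ : V ⊕ V ≃ W ⊕ W) (hs : ∀ x, sign (φ x) = sign x)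
    (hφ : ∀ x, φ x.swap = (φ x).swap) : ∃ π : V ≃ W, φ = π.sumCongr π := by
  have h1 : ∀ v, ∃ w, φ (Sum.inl v) = Sum.inl w := by
    intro v
    have := hs (Sum.inl v)
    rcases h : φ (Sum.inl v) with w | w
    · exact ⟨w, rfl⟩
    · rw [h] at this
      simp at this
  have h2 : ∀ w, ∃ v, φ (Sum.inl v) = Sum.inl w := by
    intro w
    have := hs (φ.symm (Sum.inl w))
    rcases h : φ.symm (Sum.inl w) with v | v
    · exact ⟨v, by rw [← h, φ.apply_symm_apply]⟩
    · simp [h] at this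
      rw [← h] at this
      simp at this
  choose f hf using h1
  refine ⟨Equiv.ofBijective f ⟨?_, ?_⟩, ?_⟩
  · intro v v' h
    have h3 : φ (Sum.inl v) = φ (Sum.inl v') := by rw [hf, hf, h]
    exact Sum.inl_injective (φ.injective h3)
  · intro w
    obtain ⟨v, hv⟩ := h2 w
    exact ⟨v, Sum.inl_injective ((hf v).symm.trans hv)⟩
  · ext x : 1
    rcases x with v | v
    · exact hf v
    · have := hφ (Sum.inl v)
      rw [hf] at this
      exact this

/-- By `param_eq_iff` the periods determine the set of dots of a diagram together with `turn` and
`Sum.swap`, hence also `partner`. The sign sequences make the resulting bijection respect rows. -/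
theorem exists_relabel {m : Matching (V ⊕ V)} {m' : Matching (W ⊕ W)}
    (e : Quotient m.conn ≃ Quotient m'.conn)
    (h : ∀ c, ∃ x x', Quotient.mk _ x = c ∧ Quotient.mk _ x' = e c ∧
      (∀ n : ℤ, sign ((m'.turn ^ n) x') = sign ((m.turn ^ n) x)) ∧
      (∀ n : ℤ, (m.turn ^ n) x = x ↔ (m'.turn ^ n) x' = x')) :
    ∃ π : V ≃ W, m' = m.relabel π := by
  choose x x' hx hx' hs hp using h
  have hf : Function.Bijective fun i => (Quotient.mk m.conn (x i)) := by
    simp only [hx]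
    exact Function.bijective_id
  have hg : Function.Bijective fun i => (Quotient.mk m'.conn (x' i)) := by
    simp only [hx']
    exact e.bijective
  have sf := m.param_surjective x hf.2
  obtain ⟨φ, hφ⟩ := exists_equiv_of_kernel sf (m'.param_surjective x' hg.2) (by
    intro a b
    rw [param_eq_iff _ _ hf.1, param_eq_iff _ _ hg.1, hp])
  have hturn : ∀ y, φ (m.turn y) = m'.turn (φ y) := by
    intro y
    obtain ⟨⟨i, n, s⟩, rfl⟩ := sf y
    -- On the swapped copy of an orbit, `turn` runs backwards, hence `n - 1`.
    have key : ∀ {U : Type} (m : Matching (U ⊕ U)) (x : Quotient _ → U ⊕ U),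
        m.turn (m.param x (i, n, s)) = m.param x (i, bif s then n - 1 else n + 1, s) := by
      intro U m x
      cases s
      · simp [param, add_comm n, zpow_add]
      · have h1 := m.turn_zpow_swap 1 ((m.turn ^ n) (x i))
        rw [zpow_one] at h1
        simp only [param, cond_true, h1]
        rw [sub_eq_neg_add, zpow_add]
        rfl
    rw [key, hφ, hφ, key]
  have hswap : ∀ y, φ y.swap = (φ y).swap := by
    intro y
    obtain ⟨⟨i, n, s⟩, rfl⟩ := sf y
    have key : ∀ {U : Type} (m : Matching (U ⊕ U)) (x : Quotient _ → U ⊕ U),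
        (m.param x (i, n, s)).swap = m.param x (i, n, !s) := by
      intro U m x
      cases s <;> simp [param]
    rw [key, hφ, hφ, key]
  have hsign : ∀ y, sign (φ y) = sign y := by
    intro y
    obtain ⟨⟨i, n, s⟩, rfl⟩ := sf y
    rw [hφ]
    cases s <;> simp [param, sign_swap, hs]
  obtain ⟨π, hπ⟩ := exists_sumCongr φ hsign hswap
  refine ⟨π, ?_⟩
  ext y : 2
  obtain ⟨z, rfl⟩ := φ.surjective y
  rw [relabel, ← hπ, conj_partner, φ.symm_apply_apply]
  have h1 := hturn z
  rw [turn_apply, turn_apply, hswap] at h1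
  exact (Sum.swap_rightInverse.injective h1).symm

/-! ### Reduced diagrams -/

/-- Every upper horizontal arc is above a lower horizontal arc. -/
def Reduced (m : Matching (V ⊕ V)) : Prop :=
  ∀ i j, m.partner (Sum.inl i) = Sum.inl j → m.partner (Sum.inr i) = Sum.inr j

theorem Reduced.turn_turn {m : Matching (V ⊕ V)} (hm : m.Reduced) {i j : V}
    (h : m.partner (Sum.inl i) = Sum.inl j) :
    m.turn (Sum.inl i) = Sum.inr j ∧ m.turn (Sum.inr j) = Sum.inl i := by
  have h1 := hm i j h
  constructor
  · rw [turn_apply, h]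
    rfl
  · rw [turn_apply, ← h1, partner_partner]
    rfl

/-- An upper arc in a reduced diagram lies in a component of two columns with period 2. A path
leaving a top dot by a through arc can never enter such a component, so it stays on top dots and
every edge counts with the same sign. -/
theorem Reduced.cases [Fintype V] {m : Matching (V ⊕ V)} (hm : m.Reduced) (i : V) :
    (Function.minimalPeriod m.turn (Sum.inl i) = 2 ∧ m.winding (Sum.inl i) = 0 ∧
      ∀ n : ℤ, sign ((m.turn ^ n) (Sum.inl i)) = if Even n then -1 else 1) ∨
    (m.winding (Sum.inl i) ≠ 0 ∧
      Function.minimalPeriod m.turn (Sum.inl i) = m.winding (Sum.inl i) ∧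
      ∀ n : ℤ, sign ((m.turn ^ n) (Sum.inl i)) = -1) := by
  rcases h : m.partner (Sum.inl i) with j | j
  · left
    obtain ⟨h1, h2⟩ := hm.turn_turn h
    have hper : Function.minimalPeriod m.turn (Sum.inl i) = 2 := by
      have : Fact (Nat.Prime 2) := ⟨Nat.prime_two⟩
      refine Function.minimalPeriod_eq_prime ?_ ?_
      · change m.turn (m.turn (Sum.inl i)) = _
        rw [h1, h2]
      · change m.turn (Sum.inl i) ≠ _
        rw [h1]
        simp
    refine ⟨hper, ?_, fun n => ?_⟩
    · rw [winding, orbitSum_eq_sum_range, hper]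
      simp [Finset.sum_range_succ, h1]
    · rcases Int.even_or_odd' n with ⟨k, rfl | rfl⟩
      · rw [(m.turn_zpow_eq_iff _ _).2 (by rw [hper]; exact ⟨k, rfl⟩)]
        simp
      · rw [add_comm, zpow_add, Equiv.Perm.mul_apply,
          (m.turn_zpow_eq_iff (Sum.inl i) _).2 (by rw [hper]; exact ⟨k, rfl⟩), zpow_one, h1]
        simp [Int.even_add]
  · right
    have hT : ∀ n : ℕ, ∃ k l, (m.turn ^ n) (Sum.inl i) = Sum.inl k ∧
        m.partner (Sum.inl k) = Sum.inr l := by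
      intro n
      induction n with
      | zero => exact ⟨i, j, rfl, h⟩
      | succ n ih =>
        obtain ⟨k, l, h1, h2⟩ := ih
        have h3 : m.turn (Sum.inl k) = Sum.inl l := by
          rw [turn_apply, h2]
          rfl
        rcases h4 : m.partner (Sum.inl l) with j' | j'
        -- If the next top dot were on an upper arc, its predecessor would be a bottom dot by
        -- injectivity of `turn`, but it is `Sum.inl k`.
        · obtain ⟨h5, h6⟩ := hm.turn_turn h4
          have h7 : m.turn (m.turn (Sum.inl l)) = m.turn (Sum.inl k) := by rw [h5, h6, h3]
          have h8 := m.turn.injective h7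
          rw [h5] at h8
          simp at h8
        · exact ⟨l, j', by rw [pow_succ', Equiv.Perm.mul_apply, h1, h3], h4⟩
    have hsign : ∀ n : ℤ, sign ((m.turn ^ n) (Sum.inl i)) = -1 := by
      intro n
      obtain ⟨k, -, hk⟩ := (show m.turn.SameCycle (Sum.inl i) ((m.turn ^ n) (Sum.inl i)) from
        ⟨n, rfl⟩).exists_pow_eq'
      obtain ⟨l, _, h1, _⟩ := hT k
      rw [← hk, h1]
      rfl
    have hw : m.winding (Sum.inl i) = Function.minimalPeriod m.turn (Sum.inl i) := by
      rw [winding, orbitSum_eq_sum_range, Finset.sum_congr rfl fun k _ => ?_,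
        Finset.sum_const (b := (-1 : ℤ))]
      · simp
      · rw [Equiv.Perm.iterate_eq_pow, ← zpow_natCast, hsign]
    refine ⟨?_, hw.symm, hsign⟩
    rw [hw]
    exact (Function.minimalPeriod_pos_of_mem_periodicPts
      (Function.Injective.mem_periodicPts m.turn.injective _)).ne'

/-- By `Reduced.cases` the winding number of a component fixes its period and its sign sequence from
a top dot. -/
theorem Reduced.exists_relabel [Fintype V] [Fintype W] {m : Matching (V ⊕ V)}
    {m' : Matching (W ⊕ W)} (hm : m.Reduced) (hm' : m'.Reduced) (h : SameCT m m') :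
    ∃ π : V ≃ W, m' = m.relabel π := by
  obtain ⟨e, he⟩ := h
  refine Matching.exists_relabel e fun c => ?_
  have htop : ∀ {U : Type} (m : Matching (U ⊕ U)) (c : Quotient m.conn),
      ∃ i, Quotient.mk _ (Sum.inl i) = c := by
    rintro U m ⟨x | x⟩
    · exact ⟨x, rfl⟩
    · exact ⟨x, Quotient.sound (conn_swap _ _)⟩
  obtain ⟨i, rfl⟩ := htop m c
  obtain ⟨i', hi'⟩ := htop m' (e (Quotient.mk _ (Sum.inl i)))
  have hw : m'.winding (Sum.inl i') = m.winding (Sum.inl i) := by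
    have := he (Quotient.mk _ (Sum.inl i))
    rwa [← hi'] at this
  refine ⟨_, _, rfl, hi', ?_⟩
  simp only [turn_zpow_eq_iff]
  rcases hm.cases i with ⟨h1, h2, h3⟩ | ⟨h1, h2, h3⟩ <;>
  rcases hm'.cases i' with ⟨h1', h2', h3'⟩ | ⟨h1', h2', h3'⟩
  · exact ⟨fun n => by rw [h3, h3'], fun n => by rw [h1, h1']⟩
  · exact absurd (hw.trans h2) h1'
  · exact absurd (hw.symm.trans h2') h1
  · exact ⟨fun n => by rw [h3, h3'], fun n => by rw [h2, h2', hw]⟩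

/-! ### How renamings and insertions commute -/

variable {X : Type}

theorem relabel_relabel (m : Matching (V ⊕ V)) (e : V ≃ W) (f : W ≃ X) :
    (m.relabel e).relabel f = m.relabel (e.trans f) := by
  rw [relabel, relabel, conj_conj, Equiv.sumCongr_trans, relabel]

theorem relabel_refl (m : Matching (V ⊕ V)) : m.relabel (Equiv.refl V) = m := by
  rw [relabel, Equiv.sumCongr_refl, conj_refl]

theorem relabel_partner (m : Matching (V ⊕ V)) (e : V ≃ W) (x : V ⊕ V) :
    (m.relabel e).partner (Sum.map e e x) = Sum.map e e (m.partner x) := by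
  rw [← Equiv.sumCongr_apply, relabel, conj_partner, Equiv.symm_apply_apply]
  rfl

theorem exch_apply_map (f : (V ⊕ Bool) ⊕ (V ⊕ Bool) ≃ (W ⊕ Bool) ⊕ (W ⊕ Bool)) (u : V ⊕ V)
    (u' : W ⊕ W) (h : f (old u) = old u')
    (h' : f (Sum.inr (Sum.inr false)) = Sum.inr (Sum.inr false))
    (x : (V ⊕ Bool) ⊕ (V ⊕ Bool)) : exch u' (f x) = f (exch u x) := by
  classical
  have := f.injective.swap_apply (old u) (Sum.inr (Sum.inr false)) x
  rw [h, h'] at this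
  unfold exch
  convert this

theorem conj_eq_conj {A B : Type} {m : Matching A} {m' : Matching B} (φ : A ≃ B)
    (h : ∀ x, m'.partner (φ x) = φ (m.partner x)) : m.conj φ = m' := by
  ext y : 2
  obtain ⟨x, rfl⟩ := φ.surjective y
  rw [h, conj_partner, φ.symm_apply_apply]

theorem relabel_addPair (m : Matching (V ⊕ V)) (e : V ≃ W) :
    m.addPair.relabel (e.sumCongr (Equiv.refl Bool)) = (m.relabel e).addPair := by
  refine conj_eq_conj _ ?_
  have key : ∀ x : V ⊕ V, ((e.sumCongr (Equiv.refl Bool)).sumCongr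
      (e.sumCongr (Equiv.refl Bool))) (old x) = old (Sum.map e e x) := by
    rintro (x | x) <;> rfl
  have h : ∀ x : V ⊕ V, (m.relabel e).addPair.partner (old (Sum.map e e x)) =
      ((e.sumCongr (Equiv.refl Bool)).sumCongr
      (e.sumCongr (Equiv.refl Bool))) (m.addPair.partner (old x)) := by
    intro x
    rw [addPair_old, addPair_old, key, relabel_partner]
  rintro ((x | b) | (x | b))
  · exact h (Sum.inl x)
  · rfl
  · exact h (Sum.inr x)
  · rfl

theorem relabel_insert (m : Matching (V ⊕ V)) (e : V ≃ W) (u : V ⊕ V) :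
    (m.insert u).relabel (e.sumCongr (Equiv.refl Bool)) =
      (m.relabel e).insert (Sum.map e e u) := by
  rw [insert, insert, ← relabel_addPair, relabel, relabel, conj_conj, conj_conj]
  congr 1
  ext x : 1
  refine (exch_apply_map ((e.sumCongr (Equiv.refl Bool)).sumCongr
    (e.sumCongr (Equiv.refl Bool))) _ _ ?_ rfl x).symm
  rcases u with u | u <;> rfl

theorem addPair_conj_exch (m : Matching (V ⊕ V)) (v : V ⊕ V) :
    (m.insert v).addPair = m.addPair.addPair.conj
      (open Classical in Equiv.swap (old (old v)) (old (Sum.inr (Sum.inr false)))) := by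
  classical
  symm
  refine conj_eq_conj _ ?_
  have hold : ∀ x, Equiv.swap (old (old v)) (old (Sum.inr (Sum.inr false))) (old x) =
      old (exch v x) := by
    intro x
    unfold exch
    convert old_injective.swap_apply (old v) (Sum.inr (Sum.inr false)) x
  have hl : ∀ b, Equiv.swap (old (old v)) (old (Sum.inr (Sum.inr false)))
      (Sum.inl (Sum.inr b)) = Sum.inl (Sum.inr b) := fun b =>
    Equiv.swap_apply_of_ne_of_ne (old_ne_inl _ _).symm (old_ne_inl _ _).symm
  have hr : ∀ b, Equiv.swap (old (old v)) (old (Sum.inr (Sum.inr false)))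
      (Sum.inr (Sum.inr b)) = Sum.inr (Sum.inr b) := fun b =>
    Equiv.swap_apply_of_ne_of_ne (old_ne_inr _ _).symm (old_ne_inr _ _).symm
  have key : ∀ x, (m.insert v).addPair.partner
      (Equiv.swap (old (old v)) (old (Sum.inr (Sum.inr false))) (old x)) =
      Equiv.swap (old (old v)) (old (Sum.inr (Sum.inr false)))
        (m.addPair.addPair.partner (old x)) := by
    intro x
    rw [hold, addPair_old, addPair_old, hold, insert, conj_partner, Equiv.symm_apply_apply]
  rintro ((x | b) | (x | b))
  · exact key (Sum.inl x)
  · rw [addPair_inl, hl, hl, addPair_inl]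
  · exact key (Sum.inr x)
  · rw [addPair_inr, hr, hr, addPair_inr]

/-- The exchange of two pairs of added columns. -/
def pairSwap : (V ⊕ Bool) ⊕ Bool ≃ (V ⊕ Bool) ⊕ Bool :=
  (Equiv.sumAssoc _ _ _).trans (((Equiv.refl V).sumCongr (Equiv.sumComm Bool Bool)).trans
    (Equiv.sumAssoc _ _ _).symm)

theorem relabel_pairSwap (m : Matching (V ⊕ V)) :
    m.addPair.addPair.relabel pairSwap = m.addPair.addPair := by
  refine conj_eq_conj _ ?_
  have h : ∀ x : V ⊕ V, (pairSwap.sumCongr pairSwap) (old (old x)) = old (old x) := by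
    rintro (x | x) <;> rfl
  have key : ∀ x : V ⊕ V,
      m.addPair.addPair.partner ((pairSwap.sumCongr pairSwap) (old (old x))) =
      (pairSwap.sumCongr pairSwap) (m.addPair.addPair.partner (old (old x))) := by
    intro x
    rw [h, addPair_old, addPair_old, h]
  rintro (((x | b) | b) | ((x | b) | b))
  · exact key (Sum.inl x)
  · rfl
  · rfl
  · exact key (Sum.inr x)
  · rfl
  · rfl

/-- Both sides are the image of `m.addPair.addPair`, which `pairSwap` preserves, under two
transpositions; they agree because conjugating a transposition moves its two points. The dot `exch z
(old v)` is `old v` unless `v = z`, when the new lower dot has taken its place. -/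
theorem insert_insert (m : Matching (V ⊕ V)) (v z : V ⊕ V) :
    (m.insert v).insert (old z) =
      ((m.insert z).insert (exch z (old v))).relabel pairSwap := by
  classical
  conv_lhs => rw [insert, addPair_conj_exch, ← relabel_pairSwap, relabel, conj_conj, conj_conj]
  conv_rhs => rw [insert, addPair_conj_exch, relabel, conj_conj, conj_conj]
  congr 1
  ext x : 1
  set S : Equiv.Perm ((((V ⊕ Bool) ⊕ Bool)) ⊕ ((V ⊕ Bool) ⊕ Bool)) :=
    pairSwap.sumCongr pairSwap with hS
  have hSoo : ∀ x : V ⊕ V, S (old (old x)) = old (old x) := by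
    rintro (x | x) <;> rfl
  have hS1 : S (old (Sum.inr (Sum.inr false))) = Sum.inr (Sum.inr false) := rfl
  have hS2 : S (Sum.inr (Sum.inr false)) = old (Sum.inr (Sum.inr false)) := rfl
  set T : Equiv.Perm ((((V ⊕ Bool) ⊕ Bool)) ⊕ ((V ⊕ Bool) ⊕ Bool)) :=
    Equiv.swap (old (old z)) (Sum.inr (Sum.inr false)) with hT
  have hT1 : T (old (Sum.inr (Sum.inr false))) = old (Sum.inr (Sum.inr false)) :=
    Equiv.swap_apply_of_ne_of_ne (old_injective.ne (old_ne_inr _ _).symm) (old_ne_inr _ _)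
  have hexch : exch (old z) = T := by
    unfold exch
    congr!
  have hexch2 : exch (exch z (old v)) =
      Equiv.swap (old (exch z (old v))) (Sum.inr (Sum.inr false)) := by
    rw [exch]
    congr!
  have hv : S (old (exch z (old v))) = T (old (old v)) := by
    have h1 : old (exch z (old v)) =
        Equiv.swap (old (old z)) (old (Sum.inr (Sum.inr false))) (old (old v)) := by
      unfold exch
      convert (old_injective.swap_apply (old z) (Sum.inr (Sum.inr false)) (old v)).symm
    rw [h1, ← S.injective.swap_apply, hSoo, hSoo, hS1]
  simp only [Equiv.trans_apply]
  rw [hexch, hexch2, ← S.injective.swap_apply, ← S.injective.swap_apply, hSoo, hS1, hS2, hv,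
    ← hT]
  conv_rhs => rw [← hT1, T.injective.swap_apply]

/-! ### Moving pairs of columns -/

/-- Elementary steps between diagrams: the columns are renamed, or a pair of inserted columns is
moved to another place. -/
inductive Conv : Matching (V ⊕ V) → Matching (V ⊕ V) → Prop
  | relabel (m : Matching (V ⊕ V)) (π : V ≃ V) : Conv m (m.relabel π)
  | insert {W : Type} (e : W ⊕ Bool ≃ V) (m : Matching (W ⊕ W)) (u u' : W ⊕ W) :
    Conv ((m.insert u).relabel e) ((m.insert u').relabel e)

theorem Conv.map {m m' : Matching (V ⊕ V)} (h : Conv m m') (e : V ≃ W) :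
    Conv (m.relabel e) (m'.relabel e) := by
  induction h with
  | relabel m π =>
    have := Conv.relabel (m.relabel e) ((e.symm.trans π).trans e)
    rwa [relabel_relabel, ← Equiv.trans_assoc, ← Equiv.trans_assoc, Equiv.self_trans_symm,
      Equiv.refl_trans, ← relabel_relabel] at this
  | insert f m u u' =>
    rw [relabel_relabel, relabel_relabel]
    exact Conv.insert _ _ _ _

theorem Conv.insert_self (m : Matching (W ⊕ W)) (u u' : W ⊕ W) :
    Conv (m.insert u) (m.insert u') := by
  have := Conv.insert (Equiv.refl _) m u u'
  rwa [relabel_refl, relabel_refl] at this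

open Relation

/-- If the step shifts a pair, `insert_insert` makes the shifted pair the outer one, inserted into a
diagram that is the same before and after; then it can be shifted directly. -/
theorem Conv.lift {m m' : Matching (W ⊕ W)} (h : Conv m m') (u u' : W ⊕ W) :
    ReflTransGen Conv (m.insert u) (m'.insert u') := by
  induction h with
  | relabel m π =>
    refine (ReflTransGen.single (Conv.relabel _ (π.sumCongr (Equiv.refl Bool)))).tail ?_
    rw [relabel_insert]
    exact Conv.insert_self _ _ _
  | insert f m v v' =>
    -- The added pair is parked at the old dot `v`, which exists in both diagrams since it predates
    -- the pair being shifted.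
    refine ((ReflTransGen.single (Conv.insert_self _ u (Sum.map f f (old v)))).tail
      ?_).tail (Conv.insert_self _ (Sum.map f f (old v)) u')
    rw [← relabel_insert, ← relabel_insert, insert_insert, insert_insert]
    exact ((Conv.insert_self _ _ _).map _).map _

theorem conv_insert {m m' : Matching (W ⊕ W)} (h : ReflTransGen Conv m m') (u u' : W ⊕ W)
    (e : W ⊕ Bool ≃ V) :
    ReflTransGen Conv ((m.insert u).relabel e) ((m'.insert u').relabel e) := by
  refine ReflTransGen.lift (fun m : Matching _ => m.relabel e) (fun _ _ h => Conv.map h e) _ _ ?_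
  induction h generalizing u' with
  | refl => exact ReflTransGen.single (Conv.insert_self _ _ _)
  | tail _ h ih => exact (ih u').trans (h.lift u' u')

theorem Conv.sameCT [Fintype V] {m m' : Matching (V ⊕ V)} (h : Conv m m') : SameCT m m' := by
  induction h with
  | relabel m π => exact sameCT_relabel m π
  | @insert W e m u u' =>
    have : Finite (W ⊕ Bool) := Finite.of_equiv _ e.symm
    have : Finite W := Finite.of_injective (Sum.inl : W → W ⊕ Bool) Sum.inl_injective
    have := Fintype.ofFinite W
    exact (((sameCT_insert m u).trans (sameCT_relabel _ e)).symm).trans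
      ((sameCT_insert m u').trans (sameCT_relabel _ e))

/-! ### Removing a pair of columns, and the induction -/

theorem exists_addPair (m : Matching ((W ⊕ Bool) ⊕ (W ⊕ Bool)))
    (h1 : m.partner (Sum.inl (Sum.inr true)) = Sum.inl (Sum.inr false))
    (h2 : m.partner (Sum.inr (Sum.inr true)) = Sum.inr (Sum.inr false)) :
    ∃ m₀ : Matching (W ⊕ W), m = m₀.addPair := by
  have hl : ∀ b, m.partner (Sum.inl (Sum.inr b)) = Sum.inl (Sum.inr !b) := by
    rintro (_ | _)
    · rw [← h1, partner_partner]
      rfl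
    · exact h1
  have hr : ∀ b, m.partner (Sum.inr (Sum.inr b)) = Sum.inr (Sum.inr !b) := by
    rintro (_ | _)
    · rw [← h2, partner_partner]
      rfl
    · exact h2
  have hold : ∀ x, ∃ y, m.partner (old x) = old y := by
    intro x
    have hx := m.partner_partner (old x)
    rcases h : m.partner (old x) with (w | b) | (w | b)
    · exact ⟨Sum.inl w, rfl⟩
    · rw [h, hl] at hx
      exact absurd hx.symm (old_ne_inl _ _)
    · exact ⟨Sum.inr w, rfl⟩
    · rw [h, hr] at hx
      exact absurd hx.symm (old_ne_inr _ _)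
  choose g hg using hold
  refine ⟨⟨g, fun x => old_injective ?_, fun x h => m.partner_ne (old x) ?_⟩, ?_⟩
  · rw [← hg, ← hg, partner_partner]
  · rw [hg, h]
  · ext y : 2
    rcases y with (w | b) | (w | b)
    · exact hg (Sum.inl w)
    · exact hl b
    · exact hg (Sum.inr w)
    · exact hr b

theorem exists_equiv_sum_bool [Fintype V] {i j : V} (hij : i ≠ j) :
    ∃ (n : ℕ) (e : Fin n ⊕ Bool ≃ V), e (Sum.inr true) = i ∧ e (Sum.inr false) = j := by
  classical
  have hcard : 2 ≤ Fintype.card V := by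
    rw [← Finset.card_pair hij]
    exact Finset.card_le_univ _
  have e : Fin (Fintype.card V - 2) ⊕ Bool ≃ V := Fintype.equivOfCardEq (by simp; omega)
  -- The first transposition corrects the image of `true`; the second corrects that of `false` and
  -- leaves `i` fixed.
  refine ⟨_, (e.trans (Equiv.swap (e (Sum.inr true)) i)).trans
    (Equiv.swap (Equiv.swap (e (Sum.inr true)) i (e (Sum.inr false))) j), ?_, ?_⟩
  · simp only [Equiv.trans_apply, Equiv.swap_apply_left]
    refine Equiv.swap_apply_of_ne_of_ne ?_ hij
    intro h
    have h1 : Equiv.swap (e (Sum.inr true)) i (e (Sum.inr true)) = i :=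
      Equiv.swap_apply_left _ _
    have h2 := (Equiv.injective _) (h1.trans h)
    simp at h2
  · simp only [Equiv.trans_apply, Equiv.swap_apply_left]

/-- An upper arc without a lower arc beneath it yields the pair of columns to delete; `u` is the
partner of one of their lower dots, and exchanging it with the other lower dot splits the pair off.
-/
theorem exists_insert [Fintype V] {m : Matching (V ⊕ V)} (hm : ¬ m.Reduced) :
    ∃ (n : ℕ) (e : Fin n ⊕ Bool ≃ V) (m₀ : Matching (Fin n ⊕ Fin n)) (u : Fin n ⊕ Fin n),
      m = (m₀.insert u).relabel e := by
  simp only [Reduced, not_forall] at hm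
  obtain ⟨i, j, hij, hne⟩ := hm
  obtain ⟨n, e, hi, hj⟩ := exists_equiv_sum_bool (V := V) (i := i) (j := j) (by
    rintro rfl
    exact m.partner_ne _ hij)
  refine ⟨n, e, ?_⟩
  suffices h : ∃ m₀ u, m.relabel e.symm = insert m₀ u by
    obtain ⟨m₀, u, h⟩ := h
    exact ⟨m₀, u, by rw [← h, relabel_relabel, Equiv.symm_trans_self, relabel_refl]⟩
  set D := m.relabel e.symm with hD
  have hmap : ∀ x, Sum.map e.symm e.symm (Sum.map e e x) = x := by
    rintro (x | x) <;> simp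
  have h1 : D.partner (Sum.inl (Sum.inr true)) = Sum.inl (Sum.inr false) := by
    have := m.relabel_partner e.symm (Sum.inl i)
    rw [hij, ← hi, ← hj] at this
    simpa using this
  have h2 : D.partner (Sum.inr (Sum.inr true)) ≠ Sum.inr (Sum.inr false) := by
    intro h
    have := D.relabel_partner e (Sum.inr (Sum.inr true))
    rw [h, hD, relabel_relabel, Equiv.symm_trans_self, relabel_refl] at this
    simp only [Sum.map_inr, hi, hj] at this
    exact hne this
  -- The upper new dots are joined to each other and the lower ones are not, so this partner lies in
  -- an old column.
  have h3 : ∃ u, D.partner (Sum.inr (Sum.inr true)) = old u := by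
    have hx := D.partner_partner (Sum.inr (Sum.inr true))
    rcases h : D.partner (Sum.inr (Sum.inr true)) with (w | b) | (w | b)
    · exact ⟨Sum.inl w, rfl⟩
    · rw [h] at hx
      cases b
      · rw [← h1, partner_partner] at hx
        simp at hx
      · rw [h1] at hx
        simp at hx
    · exact ⟨Sum.inr w, rfl⟩
    · cases b
      · exact absurd h h2
      · exact absurd h (D.partner_ne _)
  obtain ⟨u, hu⟩ := h3
  obtain ⟨m₀, hm₀⟩ := exists_addPair (D.conj (exch u))
    (by rw [conj_partner, exch_symm, exch_inl, h1, exch_inl])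
    (by rw [conj_partner, exch_symm, exch_true, hu, exch_old_self])
  refine ⟨m₀, u, ?_⟩
  rw [insert, ← hm₀, conj_conj]
  conv_lhs => rw [← conj_refl D]
  congr 1
  rw [← Equiv.symm_trans_self (exch u), exch_symm]

/-- Deletion of pairs terminates. The strict inequality is what `Reduced.of_sameCT` uses. -/
theorem exists_reduced (k : ℕ) : ∀ {V : Type} [Fintype V] (m : Matching (V ⊕ V)),
    Fintype.card V = k → ∃ (n : ℕ) (m₀ : Matching (Fin n ⊕ Fin n)), m₀.Reduced ∧ SameCT m m₀ ∧
      n ≤ k ∧ (¬ m.Reduced → n < k) := by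
  induction k using Nat.strong_induction_on with
  | _ k ih =>
    intro V _ m hk
    by_cases hm : m.Reduced
    · have e := Fintype.equivFinOfCardEq hk
      refine ⟨k, m.relabel e, ?_, sameCT_relabel _ _, le_rfl, fun h => absurd hm h⟩
      intro i j h
      obtain ⟨i, rfl⟩ := e.surjective i
      obtain ⟨j, rfl⟩ := e.surjective j
      have hinj : Function.Injective (Sum.map e e) := e.injective.sumMap e.injective
      have h1 := m.relabel_partner e (Sum.inl i)
      rw [Sum.map_inl, h] at h1
      have h2 := hm i j (hinj (a₁ := Sum.inl j) h1).symm
      have h3 := m.relabel_partner e (Sum.inr i)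
      rw [h2] at h3
      exact h3
    · obtain ⟨n, e, m₁, u, rfl⟩ := exists_insert hm
      have hn : n + 2 = k := by
        rw [← hk, ← Fintype.card_congr e]
        simp
      obtain ⟨n', m₀, h1, h2, h3, -⟩ := ih n (by omega) m₁ (Fintype.card_fin n)
      exact ⟨n', m₀, h1, ((sameCT_insert m₁ u).trans (sameCT_relabel _ e)).symm.trans h2,
        by omega, fun _ => by omega⟩

/-- Otherwise `m'` would shrink to a reduced diagram with fewer columns and the cycle type of `m`,
but that diagram is a renaming of `m`. -/
theorem Reduced.of_sameCT [Fintype V] {m m' : Matching (V ⊕ V)} (hm : m.Reduced)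
    (h : SameCT m m') : m'.Reduced := by
  by_contra hm'
  obtain ⟨n, m₀, h1, h2, -, h3⟩ := exists_reduced _ m' rfl
  obtain ⟨π, -⟩ := hm.exists_relabel h1 (h.trans h2)
  have := Fintype.card_congr π
  rw [Fintype.card_fin] at this
  exact absurd (h3 hm') (by omega)

/-- Diagrams of the same cycle type are connected by elementary steps. -/
theorem conv_of_sameCT (k : ℕ) : ∀ {V : Type} [Fintype V] (m m' : Matching (V ⊕ V)),
    Fintype.card V = k → SameCT m m' → ReflTransGen Conv m m' := by
  induction k using Nat.strong_induction_on with
  | _ k ih =>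
    intro V _ m m' hk h
    by_cases hm : m.Reduced
    · obtain ⟨π, rfl⟩ := hm.exists_relabel (hm.of_sameCT h) h
      exact ReflTransGen.single (Conv.relabel _ _)
    · have hm' : ¬ m'.Reduced := fun hm' => hm (hm'.of_sameCT h.symm)
      obtain ⟨n, e, m₀, u, rfl⟩ := exists_insert hm
      obtain ⟨n', e', m₀', u', rfl⟩ := exists_insert hm'
      have hn : n + 2 = k := by
        rw [← hk, ← Fintype.card_congr e]
        simp
      have hn' : n' + 2 = k := by
        rw [← hk, ← Fintype.card_congr e']
        simp
      obtain rfl : n = n' := by omega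
      have h₀ : SameCT m₀ m₀' :=
        ((sameCT_insert m₀ u).trans (sameCT_relabel _ e)).trans
          (h.trans ((sameCT_insert m₀' u').trans (sameCT_relabel _ e')).symm)
      -- The two diagrams place their pairs by different bijections `e` and `e'`; the chain is built
      -- over `e`, and a final renaming passes to `e'`.
      refine (conv_insert (ih n (by omega) m₀ m₀' (Fintype.card_fin n) h₀) u u' e).tail ?_
      have := Conv.relabel ((m₀'.insert u').relabel e) (e.symm.trans e')
      rwa [relabel_relabel, ← Equiv.trans_assoc, Equiv.self_trans_symm,
        Equiv.refl_trans] at this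

end Matching

/-! ### Products without loops -/

/-- The matching of a diagram. -/
def Diagram.toMatching {r : ℕ} (d : Diagram r) : Matching (Fin r ⊕ Fin r) :=
  ⟨d.partner, d.partner_partner, d.partner_ne⟩

/-- The diagram of a matching. -/
def Matching.toDiagram {r : ℕ} (m : Matching (Fin r ⊕ Fin r)) : Diagram r :=
  ⟨m.partner, m.partner_partner, m.partner_ne⟩

namespace Matching

variable {V W : Type}

/-- The concatenation of `a` and `b` is `c`, and there are no loops: in the equivalence relation
generated by the edges of the stack of `a` and `b`, the edges of `c` join equivalent dots and
every dot is equivalent to an outer one. -/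
def Composes (a b c : Matching (V ⊕ V)) : Prop :=
  ∀ R : Setoid ((V ⊕ V) ⊕ (V ⊕ V)),
    (∀ x, R (Sum.inl x) (Sum.inl (a.partner x))) →
    (∀ x, R (Sum.inr x) (Sum.inr (b.partner x))) →
    (∀ i, R (Sum.inl (Sum.inr i)) (Sum.inr (Sum.inl i))) →
    (∀ x, R (Sum.map Sum.inl Sum.inr x) (Sum.map Sum.inl Sum.inr (c.partner x))) ∧
      ∀ s, ∃ x, R s (Sum.map Sum.inl Sum.inr x)

theorem Composes.relabel {a b c : Matching (V ⊕ V)} (h : Composes a b c) (e : V ≃ W) :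
    Composes (a.relabel e) (b.relabel e) (c.relabel e) := by
  intro R ha hb hm
  have hout : ∀ x : V ⊕ V, Sum.map (Sum.map e e) (Sum.map e e) (Sum.map Sum.inl Sum.inr x) =
      Sum.map Sum.inl Sum.inr (Sum.map e e x) := by
    rintro (x | x) <;> rfl
  obtain ⟨h1, h2⟩ := h (R.comap (Sum.map (Sum.map e e) (Sum.map e e)))
    (fun x => by
      have := ha (Sum.map e e x)
      rwa [relabel_partner] at this)
    (fun x => by
      have := hb (Sum.map e e x)
      rwa [relabel_partner] at this)
    (fun i => hm (e i))
  constructor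
  · intro y
    obtain ⟨x, rfl⟩ := (e.sumCongr e).surjective y
    have := h1 x
    rw [Setoid.comap_rel, hout, hout, ← relabel_partner] at this
    exact this
  · intro y
    obtain ⟨s, rfl⟩ := ((e.sumCongr e).sumCongr (e.sumCongr e)).surjective y
    obtain ⟨x, hx⟩ := h2 s
    rw [Setoid.comap_rel, hout] at hx
    exact ⟨_, hx⟩

/-- The diagram whose edges are the columns. -/
def one : Matching (V ⊕ V) where
  partner := Sum.swap
  partner_partner := Sum.swap_swap
  partner_ne := by
    rintro (x | x) <;> simp

/-- Together with `perm_composes`: the two products of a row-twisted `m` with a permutation diagram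
are `m` and its renaming by `π`. -/
theorem composes_perm (m : Matching (V ⊕ V)) (π : Equiv.Perm V) :
    Composes (m.conj ((Equiv.refl V).sumCongr π)) (one.conj (π.sumCongr (Equiv.refl V))) m := by
  intro R ha hb hm
  set φ : Equiv.Perm (V ⊕ V) := (Equiv.refl V).sumCongr π
  have key : ∀ x, R (Sum.map Sum.inl Sum.inr x) (Sum.inl (φ x)) := by
    rintro (x | x)
    · exact R.refl _
    · exact R.trans (hb (Sum.inr x)) (R.symm (hm (π x)))
  have hφ : ∀ x, R (Sum.inl (φ x)) (Sum.inl (φ (m.partner x))) := by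
    intro x
    have := ha (φ x)
    rwa [conj_partner, φ.symm_apply_apply] at this
  refine ⟨fun x => R.trans (key x) (R.trans (hφ x) (R.symm (key _))), ?_⟩
  have hl : ∀ y, ∃ x, R (Sum.inl y) (Sum.map Sum.inl Sum.inr x) := by
    intro y
    obtain ⟨x, rfl⟩ := φ.surjective y
    exact ⟨x, R.symm (key x)⟩
  rintro (y | y | i)
  · exact hl y
  · obtain ⟨x, hx⟩ := hl (Sum.inr y)
    exact ⟨x, R.trans (R.symm (hm y)) hx⟩
  · exact ⟨Sum.inr i, R.refl _⟩

theorem perm_composes (m : Matching (V ⊕ V)) (π : Equiv.Perm V) :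
    Composes (one.conj (π.sumCongr (Equiv.refl V))) (m.conj ((Equiv.refl V).sumCongr π))
      (m.relabel π) := by
  intro R ha hb hm
  set φ : Equiv.Perm (V ⊕ V) := (Equiv.refl V).sumCongr π
  have h1 : ∀ i, R (Sum.inl (Sum.inl (π i))) (Sum.inr (Sum.inl i)) := by
    intro i
    have := ha (Sum.inl (π i))
    rw [conj_partner] at this
    simp only [Equiv.sumCongr_symm, Equiv.sumCongr_apply, Sum.map_inl, Equiv.symm_apply_apply,
      one, Sum.swap_inl, Sum.map_inr, Equiv.refl_apply] at this
    exact R.trans this (hm i)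
  have key : ∀ x, R (Sum.map Sum.inl Sum.inr (Sum.map π π x)) (Sum.inr (φ x)) := by
    rintro (x | x)
    · exact h1 x
    · exact R.refl _
  have hφ : ∀ x, R (Sum.inr (φ x)) (Sum.inr (φ (m.partner x))) := by
    intro x
    have := hb (φ x)
    rwa [conj_partner, φ.symm_apply_apply] at this
  have hr : ∀ y, ∃ x, R (Sum.inr y) (Sum.map Sum.inl Sum.inr x) := by
    intro y
    obtain ⟨x, rfl⟩ := φ.surjective y
    exact ⟨_, R.symm (key x)⟩
  constructor
  · intro y
    obtain ⟨x, rfl⟩ := (π.sumCongr π).surjective y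
    rw [Equiv.sumCongr_apply, relabel_partner]
    exact R.trans (key x) (R.trans (hφ x) (R.symm (key _)))
  · rintro ((i | i) | y)
    · exact ⟨Sum.inl i, R.refl _⟩
    · obtain ⟨x, hx⟩ := hr (Sum.inl i)
      exact ⟨x, R.trans (hm i) hx⟩
    · exact hr y

/-- The upper arc of the right factor reconnects the edge that the pair at `u` had interrupted,
which restores `m` on the old dots; the lower half of the right factor then inserts the pair at `k`.
-/
theorem composes_insert (m : Matching (V ⊕ V)) (u : V ⊕ V) (k : V) :
    Composes (m.insert u) (one.insert (Sum.inr k)) (m.insert (Sum.inr k)) := by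
  intro R ha hb hm
  have ht : R (Sum.inr (Sum.inl (Sum.inr true))) (Sum.inr (Sum.inl (Sum.inr false))) := by
    have := hb (Sum.inl (Sum.inr true))
    rwa [insert_inl] at this
  have ht' : R (Sum.inl (Sum.inr (Sum.inr true))) (Sum.inl (Sum.inr (Sum.inr false))) :=
    R.trans (hm _) (R.trans ht (R.symm (hm _)))
  have hau : R (Sum.inl (Sum.inr (Sum.inr true))) (Sum.inl (old u)) := by
    have := ha (Sum.inr (Sum.inr true))
    rwa [insert_true] at this
  have hau' : R (Sum.inl (Sum.inr (Sum.inr false))) (Sum.inl (old (m.partner u))) := by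
    have := ha (Sum.inr (Sum.inr false))
    rwa [insert_false] at this
  have huu : R (Sum.inl (old u)) (Sum.inl (old (m.partner u))) :=
    R.trans (R.symm hau) (R.trans ht' hau')
  have hold : ∀ x, R (Sum.inl (old x)) (Sum.inl (old (m.partner x))) := by
    intro x
    by_cases h : x = u
    · rw [h]
      exact huu
    · by_cases h' : x = m.partner u
      · rw [h', partner_partner]
        exact R.symm huu
      · have := ha (old x)
        rwa [insert_old_of_ne _ h h'] at this
  -- The outer dot standing for `old x` is `old x` itself, except that the new lower dot `false`
  -- stands for the lower dot of column `k`.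
  have key : ∀ x, R (Sum.map Sum.inl Sum.inr (exch (Sum.inr k) (old x))) (Sum.inl (old x)) := by
    intro x
    by_cases h : x = Sum.inr k
    · subst h
      rw [exch_old_self]
      have := hb (Sum.inr (Sum.inr false))
      rw [insert_false] at this
      exact R.trans this (R.symm (hm (Sum.inl k)))
    · rw [exch_old_of_ne h]
      rcases x with w | w
      · exact R.refl _
      · have := hb (old (Sum.inr w))
        rw [insert_old_of_ne _ h (by simp [one])] at this
        exact R.trans this (R.symm (hm (Sum.inl w)))
  have hlow : ∀ b, R (Sum.inr (exch (Sum.inr k) (Sum.inr (Sum.inr b))))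
      (Sum.inr (exch (Sum.inr k) (Sum.inr (Sum.inr !b)))) := by
    have h := hb (Sum.inr (Sum.inr true))
    rw [insert_true] at h
    rintro (_ | _)
    · rw [exch_false, Bool.not_false, exch_true]
      exact R.symm h
    · rw [exch_true, Bool.not_true, exch_false]
      exact h
  have hup : ∀ b, R (Sum.inl (Sum.inl (Sum.inr b))) (Sum.inl (Sum.inl (Sum.inr !b))) := by
    intro b
    have := ha (Sum.inl (Sum.inr b))
    rwa [insert_inl] at this
  have hl : ∀ y, ∃ x, R (Sum.inl y) (Sum.map Sum.inl Sum.inr x) := by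
    have h : ∀ x, ∃ z, R (Sum.inl (old x)) (Sum.map Sum.inl Sum.inr z) := fun x =>
      ⟨_, R.symm (key x)⟩
    rintro ((w | b) | (w | b))
    · exact h (Sum.inl w)
    · exact ⟨Sum.inl (Sum.inr b), R.refl _⟩
    · exact h (Sum.inr w)
    · cases b
      · exact ⟨_, R.trans hau' (R.symm (key _))⟩
      · exact ⟨_, R.trans hau (R.symm (key _))⟩
  constructor
  · intro y
    obtain ⟨x, rfl⟩ := (exch (Sum.inr k)).surjective y
    rw [insert, conj_partner, Equiv.symm_apply_apply]
    have h : ∀ x, R (Sum.map Sum.inl Sum.inr (exch (Sum.inr k) (old x)))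
        (Sum.map Sum.inl Sum.inr (exch (Sum.inr k) (m.addPair.partner (old x)))) := by
      intro x
      rw [addPair_old]
      exact R.trans (key x) (R.trans (hold x) (R.symm (key _)))
    rcases x with (w | b) | (w | b)
    · exact h (Sum.inl w)
    · rw [addPair_inl, exch_inl, exch_inl]
      exact hup b
    · exact h (Sum.inr w)
    · rw [addPair_inr]
      have h2 : ∀ b, Sum.map Sum.inl Sum.inr (exch (Sum.inr k) (Sum.inr (Sum.inr b))) =
          (Sum.inr (exch (Sum.inr k) (Sum.inr (Sum.inr b))) :
            ((V ⊕ Bool) ⊕ (V ⊕ Bool)) ⊕ ((V ⊕ Bool) ⊕ (V ⊕ Bool))) := by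
        rintro (_ | _)
        · rw [exch_false]
          rfl
        · rw [exch_true]
          rfl
      rw [h2, h2]
      exact hlow b
  · rintro (y | (c | c))
    · exact hl y
    · obtain ⟨x, hx⟩ := hl (Sum.inr c)
      exact ⟨x, R.trans (R.symm (hm c)) hx⟩
    · exact ⟨Sum.inr c, R.refl _⟩

/-- The upper arc of `m.insert u` closes the gap in column `k` of the left factor, which thus acts
as the identity on the old columns; its own upper arc replaces the one used up. -/
theorem insert_composes (m : Matching (V ⊕ V)) (u : V ⊕ V) (k : V) :
    Composes (one.insert (Sum.inr k)) (m.insert u) (m.insert u) := by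
  intro R ha hb hm
  have hb' : R (Sum.inr (Sum.inl (Sum.inr true))) (Sum.inr (Sum.inl (Sum.inr false))) := by
    have := hb (Sum.inl (Sum.inr true))
    rwa [insert_inl] at this
  have hk : R (Sum.inl (Sum.inr (Sum.inr true))) (Sum.inl (Sum.inr (Sum.inl k))) := by
    have := ha (Sum.inr (Sum.inr true))
    rwa [insert_true] at this
  have hk' : R (Sum.inl (Sum.inl (Sum.inl k))) (Sum.inl (Sum.inr (Sum.inr false))) := by
    have := ha (Sum.inr (Sum.inr false))
    rw [insert_false] at this
    exact R.symm this
  -- From the top dot of column `k` down to `false`, across the upper arc of the lower diagram to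
  -- `true`, and along the lower arc back to `k`.
  have hkk : R (Sum.inl (Sum.inl (Sum.inl k))) (Sum.inr (Sum.inl (Sum.inl k))) :=
    R.trans hk' (R.trans (hm _) (R.trans (R.symm hb') (R.trans (R.symm (hm _))
      (R.trans hk (hm _)))))
  have htop : ∀ w, R (Sum.inl (Sum.inl (Sum.inl w))) (Sum.inr (Sum.inl (Sum.inl w))) := by
    intro w
    by_cases h : w = k
    · rw [h]
      exact hkk
    · have := ha (old (Sum.inl w))
      rw [insert_old_of_ne _ (by simp) (by simpa [one] using h)] at this
      exact R.trans this (hm _)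
  have key : ∀ x, R (Sum.map Sum.inl Sum.inr (old x)) (Sum.inr (old x)) := by
    rintro (w | w)
    · exact htop w
    · exact R.refl _
  have hout : ∀ y, (∀ b, y ≠ Sum.inl (Sum.inr b)) → R (Sum.map Sum.inl Sum.inr y)
      (Sum.inr y) := by
    rintro ((w | b) | c) hy
    · exact htop w
    · exact absurd rfl (hy b)
    · exact R.refl _
  have hmid : ∀ c, ∃ x, R (Sum.inr (Sum.inl c)) (Sum.map Sum.inl Sum.inr x) := by
    rintro (w | b)
    · exact ⟨Sum.inl (Sum.inl w), R.symm (htop w)⟩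
    · have h : R (Sum.inr (Sum.inl (Sum.inr false))) (Sum.map Sum.inl Sum.inr
          (Sum.inl (Sum.inl k))) := R.trans (R.symm (hm _)) (R.symm hk')
      cases b
      · exact ⟨_, h⟩
      · exact ⟨_, R.trans hb' h⟩
  constructor
  · intro y
    by_cases hy : ∃ b, y = Sum.inl (Sum.inr b)
    · obtain ⟨b, rfl⟩ := hy
      have := ha (Sum.inl (Sum.inr b))
      rw [insert_inl] at this
      rw [insert_inl]
      exact this
    · push Not at hy
      refine R.trans (hout y hy) (R.trans (hb y) (R.symm (hout _ ?_)))
      intro b h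
      apply hy (!b)
      rw [← partner_partner (m.insert u) y, h, insert_inl]
  · rintro ((c | c) | (c | c))
    · exact ⟨Sum.inl c, R.refl _⟩
    · obtain ⟨x, hx⟩ := hmid c
      exact ⟨x, R.trans (hm c) hx⟩
    · exact hmid c
    · exact ⟨Sum.inr c, R.refl _⟩

end Matching

/-! ### From matchings to products in H -/

theorem Diagram.comp_eq {r : ℕ} {a b c : Diagram r}
    (h : ∀ x, (stackGraph a b).Reachable (outer x) (outer (c.partner x))) : a.comp b = c := by
  ext x : 2
  exact ((reachable_outer a b x).choose_spec.2 (c.partner x) ⟨c.partner_ne x, h x⟩).symm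

theorem loops_eq_zero {r : ℕ} {a b : Diagram r}
    (h : ∀ s, ∃ x, (stackGraph a b).Reachable s (outer x)) : loops a b = 0 := by
  have : IsEmpty {c : (stackGraph a b).ConnectedComponent //
      ∀ x : Dot r, (stackGraph a b).connectedComponentMk (outer x) ≠ c} := by
    refine ⟨?_⟩
    rintro ⟨c, hc⟩
    induction c using SimpleGraph.ConnectedComponent.ind with
    | _ s =>
      obtain ⟨x, hx⟩ := h s
      exact hc x (SimpleGraph.ConnectedComponent.sound hx.symm)
  exact Nat.card_of_isEmpty

/-- `Composes` is applied to reachability in the stack: its first half gives the composite diagram,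
its second half excludes loops. -/
theorem Matching.Composes.mk_mul_mk {F : Type*} [Field F] (δ : F) {r : ℕ}
    {a b c : Matching (Fin r ⊕ Fin r)} (h : Composes a b c) :
    H.mk δ 0 a.toDiagram * H.mk δ 0 b.toDiagram = H.mk δ 0 c.toDiagram := by
  obtain ⟨h1, h2⟩ := h (stackGraph a.toDiagram b.toDiagram).reachableSetoid
    (fun x => SimpleGraph.Adj.reachable
      ⟨fun h => a.partner_ne x (Sum.inl_injective h).symm, Or.inl (Or.inl rfl)⟩)
    (fun x => SimpleGraph.Adj.reachable
      ⟨fun h => b.partner_ne x (Sum.inr_injective h).symm, Or.inl (Or.inl rfl)⟩)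
    (fun i => SimpleGraph.Adj.reachable ⟨by simp, Or.inl (Or.inr ⟨i, rfl, rfl⟩)⟩)
  apply Subtype.ext
  refine (BrauerAlgebra.single_mul_single _ _ _ _).trans ?_
  rw [Diagram.comp_eq (c := c.toDiagram) h1, loops_eq_zero h2]
  simp [H.mk]

namespace Matching

variable {r : ℕ}

/-! ### The closed paths of a diagram -/

theorem reachable_iff_conn (m : Matching (Fin r ⊕ Fin r)) (x y : Dot r) :
    (closureGraph m.toDiagram).Reachable x y ↔ m.conn x y := by
  have hswap : ∀ x : Dot r, (closureGraph m.toDiagram).Reachable x x.swap := fun x =>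
    SimpleGraph.Adj.reachable ⟨by rcases x with x | x <;> simp, Or.inl (Or.inr rfl)⟩
  have hpart : ∀ x : Dot r, (closureGraph m.toDiagram).Reachable x (m.partner x) := fun x =>
    SimpleGraph.Adj.reachable ⟨(m.partner_ne x).symm, Or.inl (Or.inl rfl)⟩
  constructor
  · rintro ⟨w⟩
    induction w with
    | nil => exact m.conn.refl _
    | @cons u v _ h _ ih =>
      refine m.conn.trans ?_ ih
      rcases h with ⟨-, (h | h) | (h | h)⟩
      · rw [h]
        exact m.conn_partner _
      · rw [h]
        exact m.conn_swap _
      · rw [h]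
        exact m.conn.symm (m.conn_partner _)
      · rw [h]
        exact m.conn.symm (m.conn_swap _)
  · have key : ∀ z, m.turn.SameCycle x z → (closureGraph m.toDiagram).Reachable x z := by
      intro z h
      obtain ⟨n, -, rfl⟩ := h.exists_pow_eq'
      clear h
      induction n with
      | zero => exact SimpleGraph.Reachable.refl _
      | succ n ih =>
        rw [pow_succ', Equiv.Perm.mul_apply]
        exact ih.trans ((hpart _).trans (hswap _))
    rintro (h | h)
    · exact key y h
    · have := hswap y.swap
      rw [Sum.swap_swap] at this
      exact (key _ h).trans this

/-- Twice the direction of an edge is the sum of the signs of two consecutive dots of the orbit, so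
around a closed path the directions and the signs have equal sums. -/
theorem windingNumber_eq (m : Matching (Fin r ⊕ Fin r)) (x : Dot r) :
    windingNumber m.toDiagram x = m.winding x := by
  have hdir : ∀ y : Dot r, 2 * direction y (m.partner y) = sign y + sign (m.turn y) := by
    intro y
    rw [turn_apply]
    rcases y with y | y <;> rcases m.partner _ with z | z <;> rfl
  have hsum : 2 * ∑ k ∈ Finset.range (pathLength m.toDiagram x),
      direction ((step m.toDiagram)^[k] x) (m.partner ((step m.toDiagram)^[k] x)) =
      2 * m.orbitSum x := by
    rw [Finset.mul_sum, Finset.sum_congr rfl fun k _ => hdir _, Finset.sum_add_distrib,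
      orbitSum_eq_sum_range, two_mul]
    refine congrArg₂ (· + ·) rfl ?_
    have h1 : ∀ k, m.turn ((step m.toDiagram)^[k] x) = m.turn^[k + 1] x := fun k =>
      (Function.iterate_succ_apply' _ _ _).symm
    simp only [h1]
    have h2 := Finset.sum_range_succ (fun k => sign (m.turn^[k] x)) (pathLength m.toDiagram x)
    rw [Finset.sum_range_succ'] at h2
    have h3 : m.turn^[pathLength m.toDiagram x] x = x :=
      Function.iterate_minimalPeriod
    rw [h3] at h2
    exact add_right_cancel h2
  have := mul_left_cancel₀ two_ne_zero hsum
  exact congrArg Int.natAbs this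

/-- The leading columns correspond to the components. -/
noncomputable def leaderEquiv (m : Matching (Fin r ⊕ Fin r)) :
    leaders m.toDiagram ≃ Quotient m.conn :=
  Equiv.ofBijective (fun i => Quotient.mk _ (Sum.inl i.1)) (by
    have hmem : ∀ i, i ∈ leaders m.toDiagram ↔
        ∀ j, m.conn (Sum.inl i) (Sum.inl j) → i ≤ j := by
      intro i
      simp [leaders, reachable_iff_conn]
    constructor
    · rintro ⟨i, hi⟩ ⟨j, hj⟩ h
      have h : m.conn (Sum.inl i) (Sum.inl j) := Quotient.exact h
      exact Subtype.ext (le_antisymm ((hmem i).1 hi j h) ((hmem j).1 hj i (m.conn.symm h)))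
    · intro c
      classical
      have hne : ({i | Quotient.mk m.conn (Sum.inl i) = c} : Finset (Fin r)).Nonempty := by
        obtain ⟨x, rfl⟩ := Quotient.exists_rep c
        rcases x with i | i
        · exact ⟨i, by simp⟩
        · exact ⟨i, by simpa using Quotient.sound (m.conn_swap (Sum.inl i))⟩
      have h1 := Finset.min'_mem _ hne
      simp only [Finset.mem_filter, Finset.mem_univ, true_and] at h1
      refine ⟨⟨_, (hmem _).2 fun j hj => Finset.min'_le _ j ?_⟩, h1⟩
      simp only [Finset.mem_filter, Finset.mem_univ, true_and]
      exact (Quotient.sound (m.conn.symm hj)).trans h1)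

theorem leaderEquiv_apply (m : Matching (Fin r ⊕ Fin r)) (i : leaders m.toDiagram) :
    m.leaderEquiv i = Quotient.mk _ (Sum.inl i.1) := rfl

theorem windingOf_leaderEquiv (m : Matching (Fin r ⊕ Fin r)) (i : leaders m.toDiagram) :
    m.windingOf (m.leaderEquiv i) = windingNumber m.toDiagram (Sum.inl i.1) :=
  (m.windingNumber_eq _).symm

theorem cycleType_eq_of_sameCT {m m' : Matching (Fin r ⊕ Fin r)} (h : SameCT m m') :
    cycleType m.toDiagram = cycleType m'.toDiagram := by
  obtain ⟨e, he⟩ := h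
  unfold cycleType
  rw [← Multiset.attach_map_val' (leaders m.toDiagram).val,
    ← Multiset.attach_map_val' (leaders m'.toDiagram).val]
  set f := (m.leaderEquiv.trans e).trans m'.leaderEquiv.symm with hf
  refine (Multiset.map_congr rfl fun i _ => ?_).trans ((Multiset.map_map _ f _).symm.trans
    (congrArg _ (Multiset.map_univ_val_equiv f)))
  simp only [Function.comp_apply]
  change windingNumber m.toDiagram (Sum.inl i.1) = windingNumber m'.toDiagram (Sum.inl (f i).1)
  rw [← windingOf_leaderEquiv, ← windingOf_leaderEquiv, hf]
  simp only [Equiv.trans_apply, Equiv.apply_symm_apply]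
  exact (he _).symm

/-- Equal multisets of values mean equinumerous fibres, which are matched one value at a time. -/
theorem exists_equiv_of_map_eq {α β γ : Type} [Fintype α] [Fintype β] {f : α → γ} {g : β → γ}
    (h : (Finset.univ : Finset α).val.map f = (Finset.univ : Finset β).val.map g) :
    ∃ e : α ≃ β, ∀ a, g (e a) = f a := by
  classical
  have hc : ∀ c, Nonempty ({a // f a = c} ≃ {b // g b = c}) := by
    intro c
    have h1 := congrArg (Multiset.count c) h
    rw [Multiset.count_map, Multiset.count_map] at h1
    refine ⟨Fintype.equivOfCardEq ?_⟩
    rw [Fintype.card_subtype, Fintype.card_subtype]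
    simp only [eq_comm (b := c)]
    exact h1
  let E := fun c => (hc c).some
  refine ⟨((Equiv.sigmaFiberEquiv f).symm.trans (Equiv.sigmaCongrRight E)).trans
    (Equiv.sigmaFiberEquiv g), fun a => ?_⟩
  exact (E (f a) ⟨a, rfl⟩).2

theorem sameCT_of_cycleType_eq {m m' : Matching (Fin r ⊕ Fin r)}
    (h : cycleType m.toDiagram = cycleType m'.toDiagram) : SameCT m m' := by
  unfold cycleType at h
  rw [← Multiset.attach_map_val' (leaders m.toDiagram).val,
    ← Multiset.attach_map_val' (leaders m'.toDiagram).val] at h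
  obtain ⟨e, he⟩ := exists_equiv_of_map_eq (α := leaders m.toDiagram)
    (β := leaders m'.toDiagram) (f := fun i => windingNumber m.toDiagram (Sum.inl i.1))
    (g := fun i => windingNumber m'.toDiagram (Sum.inl i.1)) h
  refine ⟨(m.leaderEquiv.symm.trans e).trans m'.leaderEquiv, fun c => ?_⟩
  obtain ⟨i, rfl⟩ := m.leaderEquiv.surjective c
  rw [Equiv.trans_apply, Equiv.trans_apply, Equiv.symm_apply_apply, windingOf_leaderEquiv,
    windingOf_leaderEquiv]
  exact he i

/-! ### The strings of the closed paths -/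

theorem length_pathString (m : Matching (Fin r ⊕ Fin r)) (x : Dot r) :
    (pathString m.toDiagram x).length = Function.minimalPeriod m.turn x := by
  unfold pathString
  rw [List.length_map, List.length_range]
  rfl

theorem getElem_pathString (m : Matching (Fin r ⊕ Fin r)) (x : Dot r) (k : ℕ)
    (hk : k < (pathString m.toDiagram x).length) :
    (pathString m.toDiagram x)[k] = letter (m.turn^[k] x) (m.partner (m.turn^[k] x)) := by
  simp only [pathString, List.getElem_map, List.getElem_range]
  rfl

theorem pathString_iterate (m : Matching (Fin r ⊕ Fin r)) (x : Dot r) (n : ℕ) :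
    pathString m.toDiagram (m.turn^[n] x) = (pathString m.toDiagram x).rotate n := by
  have hper : Function.minimalPeriod m.turn (m.turn^[n] x) = Function.minimalPeriod m.turn x :=
    Function.minimalPeriod_apply_iterate
      (Function.Injective.mem_periodicPts m.turn.injective x) n
  refine List.ext_getElem ?_ fun k h1 h2 => ?_
  · rw [List.length_rotate, length_pathString, length_pathString, hper]
  · rw [List.getElem_rotate, getElem_pathString, getElem_pathString, length_pathString,
      Function.iterate_mod_minimalPeriod_eq, Function.iterate_add_apply]

theorem letter_comm (x y : Dot r) : letter x y = letter y x := by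
  rcases x with x | x <;> rcases y with y | y <;> rfl

theorem iterate_turn_swap (m : Matching (Fin r ⊕ Fin r)) (x : Dot r) {k l : ℕ}
    (h : m.turn^[k + l] x = x) : m.turn^[k] x.swap = (m.turn^[l] x).swap := by
  rw [Equiv.Perm.iterate_eq_pow, ← zpow_natCast, turn_zpow_swap]
  congr 1
  rw [zpow_neg, Equiv.Perm.inv_eq_iff_eq, zpow_natCast, ← Equiv.Perm.iterate_eq_pow,
    ← Function.iterate_add_apply, h]

/-- From the other dot of the column the same closed path is read backwards. -/
theorem pathString_swap (m : Matching (Fin r ⊕ Fin r)) (x : Dot r) :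
    pathString m.toDiagram x.swap = (pathString m.toDiagram x).reverse := by
  have hper : Function.minimalPeriod m.turn x.swap = Function.minimalPeriod m.turn x := by
    rw [Function.minimalPeriod_eq_minimalPeriod_iff]
    intro n
    have h1 : m.turn^[n] x.swap = (((m.turn ^ n)⁻¹ : Equiv.Perm _) x).swap := by
      rw [Equiv.Perm.iterate_eq_pow, ← zpow_natCast, turn_zpow_swap, zpow_neg]
    rw [Function.IsPeriodicPt, Function.IsFixedPt, h1, Sum.swap_rightInverse.injective.eq_iff,
      Equiv.Perm.inv_eq_iff_eq, ← Equiv.Perm.iterate_eq_pow]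
    exact eq_comm
  refine List.ext_getElem ?_ fun k h1 h2 => ?_
  · rw [List.length_reverse, length_pathString, length_pathString, hper]
  · rw [length_pathString, hper] at h1
    rw [List.getElem_reverse, getElem_pathString, getElem_pathString, length_pathString]
    obtain ⟨l, hl⟩ : ∃ l, Function.minimalPeriod m.turn x = k + (l + 1) :=
      ⟨Function.minimalPeriod m.turn x - k - 1, by omega⟩
    have hx : m.turn^[k + (l + 1)] x = x := by
      rw [← hl]
      exact Function.iterate_minimalPeriod
    -- With period k + l + 1, edge k of the reversed path is edge l of the path, started from its
    -- other end.
    rw [iterate_turn_swap m x hx, hl, show k + (l + 1) - 1 - k = l by omega,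
      Function.iterate_succ_apply', turn_apply, Sum.swap_swap, partner_partner, letter_comm]

theorem stringEquiv_of_conn (m : Matching (Fin r ⊕ Fin r)) {x y : Dot r} (h : m.conn x y) :
    StringEquiv (pathString m.toDiagram x) (pathString m.toDiagram y) := by
  rcases h with h | h
  · obtain ⟨n, -, rfl⟩ := h.exists_pow_eq'
    exact ⟨n, Or.inl (by rw [← pathString_iterate, Equiv.Perm.iterate_eq_pow])⟩
  · rw [← sameCycle_swap, Sum.swap_swap] at h
    obtain ⟨n, -, rfl⟩ := h.exists_pow_eq'
    exact ⟨n, Or.inr (by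
      rw [← pathString_swap, ← pathString_iterate, Equiv.Perm.iterate_eq_pow])⟩

theorem pathString_relabel (m : Matching (Fin r ⊕ Fin r)) (π : Equiv.Perm (Fin r)) (x : Dot r) :
    pathString (m.relabel π).toDiagram (Sum.map π π x) = pathString m.toDiagram x := by
  have hiter : ∀ k, (m.relabel π).turn^[k] (Sum.map π π x) = Sum.map π π (m.turn^[k] x) := by
    intro k
    rw [Equiv.Perm.iterate_eq_pow, Equiv.Perm.iterate_eq_pow, ← zpow_natCast, ← zpow_natCast,
      turn_zpow_relabel]
  have hper : Function.minimalPeriod (m.relabel π).turn (Sum.map π π x) =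
      Function.minimalPeriod m.turn x := by
    rw [Function.minimalPeriod_eq_minimalPeriod_iff]
    intro n
    rw [Function.IsPeriodicPt, Function.IsFixedPt, hiter]
    exact (Function.Injective.sumMap π.injective π.injective).eq_iff
  have hlet : ∀ x y : Dot r, letter (Sum.map π π x) (Sum.map π π y) = letter x y := by
    intro x y
    rcases x with x | x <;> rcases y with y | y <;> rfl
  refine List.ext_getElem ?_ fun k h1 h2 => ?_
  · rw [length_pathString, length_pathString, hper]
  · rw [getElem_pathString, getElem_pathString, hiter, relabel_partner, hlet]

/-- A renaming need not send leaders to leaders, so the leaders are matched through components; the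
strings then agree up to rotation and reversal by `stringEquiv_of_conn`. -/
theorem sameGCT_relabel (m : Matching (Fin r ⊕ Fin r)) (π : Equiv.Perm (Fin r)) :
    SameGCT m.toDiagram (m.relabel π).toDiagram := by
  set m' := m.relabel π with hm'
  set f : leaders m.toDiagram ≃ leaders m'.toDiagram :=
    (m.leaderEquiv.trans (Quotient.congr (π.sumCongr π) (m.conn_relabel π))).trans
      m'.leaderEquiv.symm with hf
  have hconn : ∀ i, m'.conn (Sum.map π π (Sum.inl i.1)) (Sum.inl (f i).1) := by
    intro i
    refine Quotient.exact (s := m'.conn) ?_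
    rw [← leaderEquiv_apply, hf]
    simp only [Equiv.trans_apply, Equiv.apply_symm_apply]
    rfl
  unfold SameGCT generalizedCycleType
  rw [← Multiset.attach_map_val' (leaders m.toDiagram).val,
    ← Multiset.attach_map_val' (leaders m'.toDiagram).val]
  have h : (leaders m'.toDiagram).val.attach = (leaders m.toDiagram).val.attach.map f :=
    (Multiset.map_univ_val_equiv f).symm
  rw [h, Multiset.map_map, Multiset.rel_map]
  refine Multiset.rel_refl_of_refl_on fun i _ => ?_
  have := m'.stringEquiv_of_conn (hconn i)
  have h2 := m.pathString_relabel π (Sum.inl i.1)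
  exact h2 ▸ this

/-! ### Elementary steps are realized in the monoid -/

section

variable {F : Type*} [Field F] (δ : F)

/-- The same `q` serves condition (ii) in one direction and (iii) in the other. -/
theorem simQ_of_mul {m m' q : Matching (Fin r ⊕ Fin r)} (h : SameCT m m')
    (h1 : Composes q m m) (h2 : Composes m q m') :
    SimQ (H.mk δ 0 m.toDiagram) (H.mk δ 0 m'.toDiagram) ∧
      SimQ (H.mk δ 0 m'.toDiagram) (H.mk δ 0 m.toDiagram) := by
  have hc := (cycleTypes_mk_zero_eq_iff (δ := δ) m.toDiagram m'.toDiagram).2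
    (cycleType_eq_of_sameCT h)
  have hq : ∃ q : H F δ r, H.mk δ 0 m.toDiagram = q * H.mk δ 0 m.toDiagram ∧
      H.mk δ 0 m'.toDiagram = H.mk δ 0 m.toDiagram * q :=
    ⟨H.mk δ 0 q.toDiagram, (h1.mk_mul_mk δ).symm, (h2.mk_mul_mk δ).symm⟩
  exact ⟨⟨hc, Or.inr (Or.inl hq)⟩, ⟨hc.symm, Or.inr (Or.inr hq)⟩⟩

theorem uvRel_of_composes {a b m m' : Matching (Fin r ⊕ Fin r)}
    (h1 : Composes a b m) (h2 : Composes b a m') :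
    UVRel (H.mk δ 0 m.toDiagram) (H.mk δ 0 m'.toDiagram) :=
  ⟨H.mk δ 0 a.toDiagram, H.mk δ 0 b.toDiagram, (h1.mk_mul_mk δ).symm, (h2.mk_mul_mk δ).symm⟩

theorem Conv.sim {m m' : Matching (Fin r ⊕ Fin r)} (h : Conv m m') :
    Sim (H.mk δ 0 m.toDiagram) (H.mk δ 0 m'.toDiagram) := by
  induction h with
  | relabel m π =>
    refine Relation.TransGen.single ⟨(cycleTypes_mk_zero_eq_iff _ _).2
      (cycleType_eq_of_sameCT (sameCT_relabel m π)), Or.inl ?_⟩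
    exact ⟨0, _, _, rfl, rfl, m.sameGCT_relabel π⟩
  | insert e m u u' =>
    -- Both positions are compared with the lower dot in the column of `u'`; any column would do.
    have key : ∀ u, _ := fun u => simQ_of_mul δ
      (Conv.insert e m u (Sum.inr (u'.elim id id))).sameCT
      ((m.insert_composes u _).relabel e) ((m.composes_insert u _).relabel e)
    exact (Relation.TransGen.single (key u).1).tail (key u').2

theorem Conv.uvConj {m m' : Matching (Fin r ⊕ Fin r)} (h : Conv m m') :
    UVConj (H.mk δ 0 m.toDiagram) (H.mk δ 0 m'.toDiagram) := by
  induction h with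
  | relabel m π =>
    exact Relation.TransGen.single (uvRel_of_composes δ (m.composes_perm π) (m.perm_composes π))
  | insert e m u u' =>
    have h1 : ∀ u, _ := fun u => (m.insert_composes u (u'.elim id id)).relabel e
    have h2 : ∀ u, _ := fun u => (m.composes_insert u (u'.elim id id)).relabel e
    exact (Relation.TransGen.single (uvRel_of_composes δ (h1 u) (h2 u))).tail
      (uvRel_of_composes δ (h2 u') (h1 u'))

end

end Matching

end Brauer

/-! ### The theorem -/

theorem mainTheorem5 {F : Type*} [Field F] (δ : F) (r : ℕ) (d₁ d₂ : Brauer.Diagram r)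
    (hd : Brauer.cycleType d₁ = Brauer.cycleType d₂) :
    Brauer.Sim (Brauer.H.mk δ 0 d₁) (Brauer.H.mk δ 0 d₂) ∧
      Brauer.UVConj (Brauer.H.mk δ 0 d₁) (Brauer.H.mk δ 0 d₂) := by
  have h := Brauer.Matching.conv_of_sameCT r d₁.toMatching d₂.toMatching (Fintype.card_fin r)
    (Brauer.Matching.sameCT_of_cycleType_eq hd)
  have hd₁ : d₁ = d₁.toMatching.toDiagram := rfl
  have hd₂ : d₂ = d₂.toMatching.toDiagram := rfl
  rw [hd₁, hd₂]
  generalize d₂.toMatching = m at h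
  clear hd hd₁ hd₂ d₂
  induction h with
  | refl =>
    -- `Relation.TransGen` needs at least one step, so reflexivity comes from the identity renaming.
    have := Brauer.Matching.Conv.relabel d₁.toMatching (Equiv.refl _)
    rw [Brauer.Matching.relabel_refl] at this
    exact ⟨this.sim δ, this.uvConj δ⟩
  | tail _ h ih => exact ⟨ih.1.trans (h.sim δ), ih.2.trans (h.uvConj δ)⟩
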